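/- Let $\mathbb T=\mathbb R/2\pi\mathbb Z$ carry the normalized Lebesgue measure $\mathrm dx$ (total mass $1$), and consider the Vlasov–HMF equation on $\mathbb T\times\mathbb R$ $$\partial_t f+\{f,H[f]\}=0,\qquad H[f](x,v)=\frac{v^2}{2}-\int_{\mathbb T\times\mathbb R}\cos(x-y)f(y,w)\,\mathrm dy\,\mathrm dw,\qquad \{f,g\}=\partial_xf\,\partial_vg-\partial_vf\,\partial_xg .$$ For $M_0>0$ let $h_0(x,v)=\frac{v^2}{2}-M_0\cos x$ be the pendulum Hamiltonian, $U_\pm=\{\pm v>0,\ h_0>M_0\}$, $U_\circ=\{h_0<M_0\}$, and let $(\theta,a)\in(-\pi,\pi)\times J_*$, with $J_\pm=(\frac4\pi\sqrt{M_0},\infty)$ and $J_\circ=(0,\frac8\pi\sqrt{M_0})$, be the action-angle variables of $h_0$ on $U_*$, $*\in\{+,-,\circ\}$. Explicitly, let $I_\pm=(M_0,\infty)$, $I_\circ=(-M_0,M_0)$, $k=k(h)=\sqrt{(h+M_0)/(2M_0)}$, let $F(\varphi,k)=\int_0^\varphi(1-k^2\sin^2y)^{-1/2}\mathrm dy$,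 $K(k)=F(\frac\pi2,k)$, $E(k)=\int_0^{\pi/2}(1-k^2\sin^2y)^{1/2}\mathrm dy$, let $\mathrm{am}(\cdot,k)$ be the inverse of $F(\cdot,k)$, and $\mathrm{sn}=\sin\mathrm{am}$. Then the action of the orbit of energy $h\in I_*$ and the position on it at angle $\theta$ are $$a_\pm(h)=\tfrac4\pi k\sqrt{M_0}\,E(\tfrac1k),\qquad x(\theta,h)=\pm2\,\mathrm{am}\big(\tfrac1\pi K(\tfrac1k)\theta,\tfrac1k\big)\qquad\text{on }U_\pm,$$ $$a_\circ(h)=\tfrac{8\sqrt{M_0}}\pi\big(E(k)-(1-k^2)K(k)\big),\qquad x(\theta,h)=2\arcsin\!\big(k\,\mathrm{sn}(\tfrac2\pi K(k)(\theta+\tfrac\pi2),k)\big)\qquad\text{on }U_\circ,$$ $h_0(a)$ denotes the inverse of $a_*:I_*\to J_*$, and $x(\theta,a)=x(\theta,h_0(a))$. Put $C_0^*(a)=\frac1{2\pi}\int_{-\pi}^{\pi}\cos(x(\theta,a))\,\mathrm d\theta$. A state $\eta=G(h_0)$ is called linearly stable if the following integrals converge absolutely and $$1+\int_{\mathbb T\times\mathbb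 R}G'(h_0(x,v))\cos^2(x)\,\mathrm dx\,\mathrm dv-\sum_{*\in\{+,-,\circ\}}\int_{J_*}G'(h_0(a))\,C_0^*(a)^2\,\mathrm da>0 .$$ **Proposition.** Let $\alpha,\beta>0$ with $\alpha^2\beta<\frac2\pi$. Then there is $M_0>0$ satisfying the self-consistency equation $$M_0=\int_{\mathbb T\times\mathbb R}\cos(x)\,\alpha e^{-\beta\left(\frac{v^2}{2}-M_0\cos x\right)}\,\mathrm dx\,\mathrm dv$$ (the integral converging absolutely), such that $$\eta(x,v)=\alpha e^{-\beta\left(\frac{v^2}{2}-M_0\cos x\right)}$$ is a stationary solution of the Vlasov–HMF equation (that is, $\eta$ is integrable, $C^1$, $2\pi$-periodic in $x$, and $\{\eta,H[\eta]\}=0$) and is linearly stable (with profile $G(s)=\alpha e^{-\beta s}$). -/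

import Mathlib

open MeasureTheory

namespace HMF

noncomputable section

/-- Normalized Lebesgue measure `dx / 2π` on the fundamental domain `(-π, π]` of the torus
`ℝ / 2πℤ`. Functions on the torus are represented by `2π`-periodic functions on `ℝ`. -/
def torusMeasure : Measure ℝ :=
  ENNReal.ofReal (2 * Real.pi)⁻¹ • volume.restrict (Set.Ioc (-Real.pi) Real.pi)

/-- The measure `dx dv` on the phase space `𝕋 × ℝ`, with `dx` normalized. -/
def phaseMeasure : Measure (ℝ × ℝ) := torusMeasure.prod volume

/-! ### The Vlasov-HMF equation and its stationary states -/

/-- The Poisson bracket `{f, g} = ∂ₓf ∂ᵥg - ∂ᵥf ∂ₓg`. -/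
def poissonBracket (f g : ℝ → ℝ → ℝ) (x v : ℝ) : ℝ :=
  deriv (fun y => f y v) x * deriv (fun w => g x w) v
    - deriv (fun w => f x w) v * deriv (fun y => g y v) x

/-- The potential `φ[f](x) = ∫ cos (x - y) f(y, w) dy dw`. -/
def potential (f : ℝ → ℝ → ℝ) (x : ℝ) : ℝ :=
  ∫ p : ℝ × ℝ, Real.cos (x - p.1) * f p.1 p.2 ∂phaseMeasure

/-- The Hamiltonian `H[f](x, v) = v² / 2 - φ[f](x)`. -/
def hamiltonian (f : ℝ → ℝ → ℝ) (x v : ℝ) : ℝ := v ^ 2 / 2 - potential f x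

/-- `f` is a (classical, integrable) stationary solution of the Vlasov-HMF equation
`∂ₜ f + {f, H[f]} = 0` on `𝕋 × ℝ`. -/
structure IsStationarySolution (f : ℝ → ℝ → ℝ) : Prop where
  contDiff : ContDiff ℝ 1 (fun p : ℝ × ℝ => f p.1 p.2)
  periodic : ∀ x v, f (x + 2 * Real.pi) v = f x v
  integrable : Integrable (fun p : ℝ × ℝ => f p.1 p.2) phaseMeasure
  bracket_eq_zero : ∀ x v, poissonBracket f (hamiltonian f) x v = 0

/-- The pendulum Hamiltonian `h₀(x, v) = v² / 2 - M₀ cos x`. -/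
def h0 (M₀ x v : ℝ) : ℝ := v ^ 2 / 2 - M₀ * Real.cos x

/-- The state `η(x, v) = G(h₀(x, v))` with profile `G` and magnetization `M₀`. -/
def state (G : ℝ → ℝ) (M₀ x v : ℝ) : ℝ := G (h0 M₀ x v)

/-- The self-consistency equation `M₀ = 𝒞[G(h₀)] = ∫ cos x G(h₀(x, v)) dx dv`
(the integral being absolutely convergent). -/
def SelfConsistent (G : ℝ → ℝ) (M₀ : ℝ) : Prop :=
  Integrable (fun p : ℝ × ℝ => Real.cos p.1 * state G M₀ p.1 p.2) phaseMeasure ∧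
    M₀ = ∫ p : ℝ × ℝ, Real.cos p.1 * state G M₀ p.1 p.2 ∂phaseMeasure

/-! ### Elliptic integrals and elliptic functions (modulus `k`, `0 ≤ k < 1`) -/

/-- The incomplete elliptic integral of the first kind. -/
def ellipticF (φ k : ℝ) : ℝ := ∫ y in (0 : ℝ)..φ, 1 / Real.sqrt (1 - k ^ 2 * Real.sin y ^ 2)

/-- The incomplete elliptic integral of the second kind. -/
def ellipticE (φ k : ℝ) : ℝ := ∫ y in (0 : ℝ)..φ, Real.sqrt (1 - k ^ 2 * Real.sin y ^ 2)

/-- The complete elliptic integral of the first kind. -/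
def completeK (k : ℝ) : ℝ := ellipticF (Real.pi / 2) k

/-- The complete elliptic integral of the second kind. -/
def completeE (k : ℝ) : ℝ := ellipticE (Real.pi / 2) k

/-- The Jacobi amplitude: `am(·, k)` is the inverse of the bijection `F(·, k) : ℝ → ℝ`. -/
def jacobiAm (u k : ℝ) : ℝ := Function.invFun (fun φ => ellipticF φ k) u

def jacobiSn (u k : ℝ) : ℝ := Real.sin (jacobiAm u k)

def jacobiCn (u k : ℝ) : ℝ := Real.cos (jacobiAm u k)

def jacobiDn (u k : ℝ) : ℝ := Real.sqrt (1 - k ^ 2 * jacobiSn u k ^ 2)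

/-! ### Action-angle variables of the pendulum -/

/-- The three charts: `plus` and `minus` are `U_± = {±v > 0, h₀ > M₀}`, outside the separatrix,
and `eye` is `U_∘ = {h₀ < M₀}`. -/
inductive Chart
  | plus
  | minus
  | eye

/-- The modulus `k(h) = √((h + M₀) / (2 M₀))`. -/
def modulus (M₀ h : ℝ) : ℝ := Real.sqrt ((h + M₀) / (2 * M₀))

/-- The range `I_*` of the energy in each chart. -/
def energyRange (M₀ : ℝ) : Chart → Set ℝ
  | .plus => Set.Ioi M₀
  | .minus => Set.Ioi M₀
  | .eye => Set.Ioo (-M₀) M₀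

/-- The range `J_*` of the action in each chart. -/
def actionRange (M₀ : ℝ) : Chart → Set ℝ
  | .plus => Set.Ioi (4 / Real.pi * Real.sqrt M₀)
  | .minus => Set.Ioi (4 / Real.pi * Real.sqrt M₀)
  | .eye => Set.Ioo 0 (8 / Real.pi * Real.sqrt M₀)

/-- The action outside the separatrix, as a function of the energy. -/
def outerAction (M₀ h : ℝ) : ℝ :=
  4 / Real.pi * modulus M₀ h * Real.sqrt M₀ * completeE (1 / modulus M₀ h)

/-- The action inside the eye, as a function of the energy. -/
def eyeAction (M₀ h : ℝ) : ℝ :=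
  8 * Real.sqrt M₀ / Real.pi *
    (completeE (modulus M₀ h) - (1 - modulus M₀ h ^ 2) * completeK (modulus M₀ h))

/-- The action `a_*(h)` of the orbit of energy `h`; it maps `I_*` bijectively onto `J_*`. -/
def action (M₀ : ℝ) : Chart → ℝ → ℝ
  | .plus => outerAction M₀
  | .minus => outerAction M₀
  | .eye => eyeAction M₀

/-- The energy `h₀(a)`, as a function of the action: the inverse of `a_* : I_* → J_*`. -/
def energyOfAction (M₀ : ℝ) (c : Chart) (a : ℝ) : ℝ :=
  Function.invFunOn (action M₀ c) (energyRange M₀ c) a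

/-- The position `x(θ, h)` in each chart. -/
def position (M₀ : ℝ) (c : Chart) (θ h : ℝ) : ℝ :=
  match c with
  | .plus => 2 * jacobiAm (1 / Real.pi * completeK (1 / modulus M₀ h) * θ) (1 / modulus M₀ h)
  | .minus =>
      -(2 * jacobiAm (1 / Real.pi * completeK (1 / modulus M₀ h) * θ) (1 / modulus M₀ h))
  | .eye =>
      2 * Real.arcsin (modulus M₀ h *
        jacobiSn (2 / Real.pi * completeK (modulus M₀ h) * (θ + Real.pi / 2)) (modulus M₀ h))

/-- The velocity `v(θ, h)` in each chart. -/
def velocity (M₀ : ℝ) (c : Chart) (θ h : ℝ) : ℝ :=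
  match c with
  | .plus => 2 * modulus M₀ h * Real.sqrt M₀ *
      jacobiDn (1 / Real.pi * completeK (1 / modulus M₀ h) * θ) (1 / modulus M₀ h)
  | .minus => -(2 * modulus M₀ h * Real.sqrt M₀ *
      jacobiDn (1 / Real.pi * completeK (1 / modulus M₀ h) * θ) (1 / modulus M₀ h))
  | .eye => 2 * modulus M₀ h * Real.sqrt M₀ *
      jacobiCn (2 / Real.pi * completeK (modulus M₀ h) * (θ + Real.pi / 2)) (modulus M₀ h)

/-- The zeroth Fourier coefficient in the angle,
`f₀*(a) = (1 / 2π) ∫_{-π}^{π} f(x(θ, a), v(θ, a)) dθ`, of a function `f` on phase space. -/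
def angleMean (M₀ : ℝ) (c : Chart) (f : ℝ → ℝ → ℝ) (a : ℝ) : ℝ :=
  1 / (2 * Real.pi) * ∫ θ in (-Real.pi)..Real.pi,
    f (position M₀ c θ (energyOfAction M₀ c a)) (velocity M₀ c θ (energyOfAction M₀ c a))

/-- `C₀*(a)`, the zeroth Fourier coefficient of `θ ↦ cos (x(θ, a))`. -/
def cosCoeff (M₀ : ℝ) (c : Chart) (a : ℝ) : ℝ := angleMean M₀ c (fun x _ => Real.cos x) a

/-- The integral `∫_{J_*} G'(h₀(a)) C₀*(a)² da`. -/
def actionIntegral (G : ℝ → ℝ) (M₀ : ℝ) (c : Chart) : ℝ :=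
  ∫ a in actionRange M₀ c, deriv G (energyOfAction M₀ c a) * cosCoeff M₀ c a ^ 2

/-- Linear stability of the state `η = G(h₀)`: all the integrals converge absolutely and
`1 + ∫ G'(h₀) cos² x dx dv - ∑_* ∫_{J_*} G'(h₀(a)) C₀*(a)² da > 0`. -/
def LinearlyStable (G : ℝ → ℝ) (M₀ : ℝ) : Prop :=
  Integrable (fun p : ℝ × ℝ => deriv G (h0 M₀ p.1 p.2) * Real.cos p.1 ^ 2) phaseMeasure ∧
  (∀ c : Chart, IntegrableOn
    (fun a => deriv G (energyOfAction M₀ c a) * cosCoeff M₀ c a ^ 2) (actionRange M₀ c)) ∧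
  0 < 1 + (∫ p : ℝ × ℝ, deriv G (h0 M₀ p.1 p.2) * Real.cos p.1 ^ 2 ∂phaseMeasure)
    - (actionIntegral G M₀ .plus + actionIntegral G M₀ .minus + actionIntegral G M₀ .eye)

/-- The Maxwell-Boltzmann profile `G(s) = α e^{-β s}`. -/
def maxwellBoltzmann (α β s : ℝ) : ℝ := α * Real.exp (-β * s)

end

end HMF

open MeasureTheory

namespace HMF

noncomputable section

/-! ### Differentiation under the integral sign -/

/-! Write `A_n(z) = ∫ cosⁿ x e^{z cos x} dx` over a period and `z = β M₀`. The velocity integral is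
Gaussian, so `∫ cosⁿ x η dx dv = N A_n(z)` with `N = α √(2π/β) / (2π)`, and self-consistency reads
`M₀ = N A₁(z)`, that is `2π z = c A₁(z)` with `c = α √(2πβ)`. The hypothesis says exactly `c < 2`.
Since `A₁(0) = 0` and `A₁'(0) = π`, the left side is larger for small `z > 0`; since `A₁` grows
superlinearly, the right side is larger for big `z`; a positive root lies in between
(`exists_pos_eq_cosExpIntegral`). For such `M₀` the potential of `η` is `M₀ cos x`, so `H[η] = h₀`,
and `η`, a function of `h₀`, is stationary.

Stability holds at every positive self-consistent `M₀`. Because `G' = -β G`, a lower bound on `S = ∑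
∫ G(h₀(a)) C₀(a)² da` is needed. In the energy variable, `a'(h)` is the density of `dx dv` and
`a'(h) C₀` that of `cos x dx dv` (`energyWeight_one`, `actionDeriv_mul_cosMean`,
`lintegral_phaseMeasure_energy`). Hence the sums of `∫ G da` and `∫ G C₀ da` are `N A₀` and `M₀`,
and Cauchy-Schwarz, in the form `C₀² ≥ 2 t C₀ - t²` with `t = A₁ / A₀`, gives `S ≥ t M₀`
(`chart_lower_bound`).

It remains to see that `1 - β N A₂ + β t M₀ > 0`. Substituting `N = M₀ / A₁` and `z (A₀ - A₂) = A₁`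
turns this into `z (A₀² - A₁²) < 2 A₀ A₁`, Turán's inequality for Bessel functions
(`turan_cosExpIntegral`). -/

theorem hasDerivAt_intervalIntegral_param {p p' : ℝ → ℝ → ℝ} {U : Set ℝ} (hU : IsOpen U)
    (hp : ContinuousOn (Function.uncurry p) (U ×ˢ Set.univ))
    (hp' : ContinuousOn (Function.uncurry p') (U ×ˢ Set.univ))
    (hd : ∀ u ∈ U, ∀ t, HasDerivAt (fun u => p u t) (p' u t) u)
    {u₀ : ℝ} (hu₀ : u₀ ∈ U) (a b : ℝ) :
    HasDerivAt (fun u => ∫ t in a..b, p u t) (∫ t in a..b, p' u₀ t) u₀ := by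
  obtain ⟨ε, hε, hball⟩ := Metric.nhds_basis_closedBall.mem_iff.1 (hU.mem_nhds hu₀)
  have slice : ∀ q : ℝ → ℝ → ℝ, ContinuousOn (Function.uncurry q) (U ×ˢ Set.univ) →
      ∀ u ∈ U, Continuous (q u) := by
    intro q hq u hu
    have := hq.comp (f := fun t : ℝ => (u, t)) (s := Set.univ) (by fun_prop)
      (fun t _ => ⟨hu, trivial⟩)
    exact continuousOn_univ.1 this
  -- The dominating function is a constant: `p'` is bounded on the compact product of a small ball
  -- of parameters and the interval.
  have hcomp : IsCompact (Metric.closedBall u₀ ε ×ˢ Set.uIcc a b) :=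
    (isCompact_closedBall _ _).prod isCompact_uIcc
  obtain ⟨C, hC⟩ := hcomp.exists_bound_of_continuousOn
    (hp'.mono (Set.prod_mono hball (Set.subset_univ _)))
  refine (intervalIntegral.hasDerivAt_integral_of_dominated_loc_of_deriv_le (bound := fun _ => C)
    (Metric.closedBall_mem_nhds u₀ hε) ?_ ?_ ?_ ?_ ?_ ?_).2
  · filter_upwards [hU.mem_nhds hu₀] with u hu
    exact (slice p hp u hu).aestronglyMeasurable
  · exact (slice p hp u₀ hu₀).intervalIntegrable _ _
  · exact (slice p' hp' u₀ hu₀).aestronglyMeasurable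
  · exact Filter.Eventually.of_forall fun t ht u hu =>
      hC (u, t) ⟨hu, Set.uIoc_subset_uIcc ht⟩
  · exact intervalIntegrable_const
  · exact Filter.Eventually.of_forall fun t _ u hu => hd u (hball hu) t

/-! ### Modified Bessel functions, in the unnormalized form `∫ cosⁿ x e^{z cos x} dx` -/

def cosExpIntegral (n : ℕ) (z : ℝ) : ℝ :=
  ∫ x in (-Real.pi)..Real.pi, Real.cos x ^ n * Real.exp (z * Real.cos x)

theorem hasDerivAt_cosExpIntegral (n : ℕ) (z : ℝ) :
    HasDerivAt (cosExpIntegral n) (cosExpIntegral (n + 1) z) z := by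
  refine hasDerivAt_intervalIntegral_param
    (p := fun z x => Real.cos x ^ n * Real.exp (z * Real.cos x))
    (p' := fun z x => Real.cos x ^ (n + 1) * Real.exp (z * Real.cos x)) isOpen_univ
    (by unfold Function.uncurry; fun_prop) (by unfold Function.uncurry; fun_prop) ?_
    (Set.mem_univ z) _ _
  intro u _ t
  have h : HasDerivAt (fun u : ℝ => u * Real.cos t) (Real.cos t) u := by
    simpa using (hasDerivAt_id u).mul_const (Real.cos t)
  exact (h.exp.const_mul (Real.cos t ^ n)).congr_deriv (by ring)

theorem continuous_cosExpIntegral (n : ℕ) : Continuous (cosExpIntegral n) :=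
  continuous_iff_continuousAt.2 fun z => (hasDerivAt_cosExpIntegral n z).continuousAt

theorem cosExpIntegral_zero_pos (z : ℝ) : 0 < cosExpIntegral 0 z := by
  refine intervalIntegral.intervalIntegral_pos_of_pos
    (Continuous.intervalIntegrable (by fun_prop) _ _)
    (fun x => by positivity) (by linarith [Real.pi_pos])

/-- The derivative of `sin x e^{z cos x}` integrates to zero over a period. This eliminates `A₂` in
favour of `A₀` and `A₁`. -/
theorem cosExpIntegral_by_parts (z : ℝ) :
    z * (cosExpIntegral 0 z - cosExpIntegral 2 z) = cosExpIntegral 1 z := by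
  have hd : ∀ x : ℝ, HasDerivAt (fun x => Real.sin x * Real.exp (z * Real.cos x))
      (Real.cos x ^ 1 * Real.exp (z * Real.cos x) - z * (Real.cos x ^ 0 * Real.exp (z * Real.cos x)
        - Real.cos x ^ 2 * Real.exp (z * Real.cos x))) x := by
    intro x
    have h := (Real.hasDerivAt_sin x).mul (((Real.hasDerivAt_cos x).const_mul z).exp)
    refine h.congr_deriv ?_
    have := Real.sin_sq_add_cos_sq x
    linear_combination -(z * Real.exp (z * Real.cos x)) * this
  have h := intervalIntegral.integral_eq_sub_of_hasDerivAt (a := -Real.pi) (b := Real.pi)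
    (fun x _ => hd x) (Continuous.intervalIntegrable (by fun_prop) _ _)
  rw [intervalIntegral.integral_sub (Continuous.intervalIntegrable (by fun_prop) _ _)
    (Continuous.intervalIntegrable (by fun_prop) _ _), intervalIntegral.integral_const_mul,
    intervalIntegral.integral_sub (Continuous.intervalIntegrable (by fun_prop) _ _)
    (Continuous.intervalIntegrable (by fun_prop) _ _)] at h
  simp only [Real.sin_pi, Real.sin_neg] at h
  unfold cosExpIntegral
  linarith

theorem cosExpIntegral_one_zero : cosExpIntegral 1 0 = 0 := by
  rw [← cosExpIntegral_by_parts]; simp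

theorem cosExpIntegral_two_zero : cosExpIntegral 2 0 = Real.pi := by
  simp [cosExpIntegral, integral_cos_sq]

/-- `I₁(z) > 0` for `z > 0`. -/
theorem cosExpIntegral_one_pos {z : ℝ} (hz : 0 < z) : 0 < cosExpIntegral 1 z := by
  -- This writes `A₁` as `z ∫ sin² x e^{z cos x} dx`, whose integrand is nonnegative and is positive
  -- at `π / 2`.
  rw [← cosExpIntegral_by_parts]
  refine mul_pos hz ?_
  unfold cosExpIntegral
  rw [← intervalIntegral.integral_sub (Continuous.intervalIntegrable (by fun_prop) _ _)
    (Continuous.intervalIntegrable (by fun_prop) _ _)]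
  refine intervalIntegral.integral_pos (by linarith [Real.pi_pos]) (by fun_prop) ?_
    ⟨Real.pi / 2, ⟨by linarith [Real.pi_pos], by linarith [Real.pi_pos]⟩, by simp⟩
  intro x _
  have h1 : Real.cos x ^ 2 ≤ 1 := Real.cos_sq_le_one x
  have h2 := Real.exp_pos (z * Real.cos x)
  nlinarith

/-- Turán's inequality `I₀ I₂ < I₁²`, written by means of `I₂(z) = I₀(z) - 2 I₁(z) / z`. -/
theorem turan_cosExpIntegral {z : ℝ} (hz : 0 < z) :
    z * (cosExpIntegral 0 z ^ 2 - cosExpIntegral 1 z ^ 2)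
      < 2 * cosExpIntegral 0 z * cosExpIntegral 1 z := by
  -- After multiplication by `s`, the difference of the two sides vanishes at `0`, and integration
  -- by parts collapses its derivative to `2 s A₁²`.
  have hd : ∀ s : ℝ, HasDerivAt (fun s => 2 * s * (cosExpIntegral 0 s * cosExpIntegral 1 s)
      - s ^ 2 * (cosExpIntegral 0 s ^ 2 - cosExpIntegral 1 s ^ 2))
      (2 * s * cosExpIntegral 1 s ^ 2) s := by
    intro s
    have h0 := hasDerivAt_cosExpIntegral 0 s
    have h1 := hasDerivAt_cosExpIntegral 1 s
    have hs := hasDerivAt_id s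
    have h := ((hs.const_mul 2).mul (h0.mul h1)).sub ((hs.pow 2).mul ((h0.pow 2).sub (h1.pow 2)))
    refine h.congr_deriv ?_
    have hp := cosExpIntegral_by_parts s
    simp only [id, zero_add, Nat.reduceAdd, Nat.cast_ofNat, pow_one, mul_one, Pi.pow_apply,
      Nat.reduceSub, Pi.mul_apply, Pi.sub_apply]
    linear_combination (-2 * cosExpIntegral 0 s - 2 * s * cosExpIntegral 1 s) * hp
  have hmono : StrictMonoOn (fun s => 2 * s * (cosExpIntegral 0 s * cosExpIntegral 1 s)
      - s ^ 2 * (cosExpIntegral 0 s ^ 2 - cosExpIntegral 1 s ^ 2)) (Set.Ici 0) := by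
    refine strictMonoOn_of_deriv_pos (convex_Ici 0)
      (fun s _ => (hd s).continuousAt.continuousWithinAt) ?_
    intro s hs
    rw [interior_Ici] at hs
    rw [(hd s).deriv]
    have hs' : 0 < s := hs
    have := cosExpIntegral_one_pos hs'
    positivity
  have h := hmono Set.self_mem_Ici hz.le hz
  simp only [mul_zero, zero_mul, ne_eq, OfNat.ofNat_ne_zero, not_false_eq_true, zero_pow,
    sub_zero] at h
  by_contra hcon
  nlinarith

/-- Any superlinear bound would do. With `t = cos x`: for `t ≥ 0` the quadratic Taylor bound gives
`t e^{zt} ≥ z² t³ / 2 ≥ z² (t³ + t⁴) / 4`; for `t ≤ 0` the polynomial is nonpositive and `t e^{zt} ≥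
-1`. Over a period `cos³` integrates to `0` and `cos⁴` to `3π / 4`. -/
theorem cosExpIntegral_one_lower_bound {z : ℝ} (hz : 0 ≤ z) :
    z ^ 2 / 4 * (3 * Real.pi / 4) - 2 * Real.pi ≤ cosExpIntegral 1 z := by
  have hpt : ∀ x : ℝ, z ^ 2 / 4 * (Real.cos x ^ 3 + Real.cos x ^ 4) - 1
      ≤ Real.cos x ^ 1 * Real.exp (z * Real.cos x) := by
    intro x
    have h1 := Real.neg_one_le_cos x
    have h2 := Real.cos_le_one x
    generalize Real.cos x = t at h1 h2
    rcases le_total 0 t with ht | ht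
    · have he := Real.quadratic_le_exp_of_nonneg (mul_nonneg hz ht)
      have h3 : t * (1 + z * t + (z * t) ^ 2 / 2) ≤ t * Real.exp (z * t) :=
        mul_le_mul_of_nonneg_left he ht
      have h4 : 0 ≤ z * t ^ 2 := by positivity
      have h5 : 0 ≤ z ^ 2 * t ^ 3 * (1 - t) := by
        have : 0 ≤ 1 - t := by linarith
        positivity
      nlinarith
    · have he : Real.exp (z * t) ≤ 1 := Real.exp_le_one_iff.2 (mul_nonpos_of_nonneg_of_nonpos hz ht)
      have h3 : t * 1 ≤ t * Real.exp (z * t) := mul_le_mul_of_nonpos_left he ht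
      have h5 : 0 ≤ z ^ 2 * (-t) ^ 3 * (1 + t) := by
        have : 0 ≤ 1 + t := by linarith
        have : 0 ≤ -t := by linarith
        positivity
      nlinarith
  have h := intervalIntegral.integral_mono (a := -Real.pi) (b := Real.pi) (μ := volume)
    (by linarith [Real.pi_pos])
    (Continuous.intervalIntegrable (by fun_prop) _ _)
    (Continuous.intervalIntegrable (by fun_prop) _ _) hpt
  have h3 : ∫ x in (-Real.pi)..Real.pi, Real.cos x ^ 3 = 0 := by
    rw [integral_cos_pow]; simp
  have h4 : ∫ x in (-Real.pi)..Real.pi, Real.cos x ^ 4 = 3 * Real.pi / 4 := by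
    rw [integral_cos_pow, integral_cos_sq]; simp; ring
  rw [intervalIntegral.integral_sub (Continuous.intervalIntegrable (by fun_prop) _ _)
    (Continuous.intervalIntegrable (by fun_prop) _ _), intervalIntegral.integral_const_mul,
    intervalIntegral.integral_add (Continuous.intervalIntegrable (by fun_prop) _ _)
    (Continuous.intervalIntegrable (by fun_prop) _ _), h3, h4] at h
  simp only [intervalIntegral.integral_const, smul_eq_mul] at h
  unfold cosExpIntegral
  linarith

/-- For `0 < c < 2` the equation `z = c I₁(z)` has a positive solution. -/
theorem exists_pos_eq_cosExpIntegral {c : ℝ} (hc : 0 < c) (hc2 : c < 2) :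
    ∃ z : ℝ, 0 < z ∧ 2 * Real.pi * z = c * cosExpIntegral 1 z := by
  have hπ := Real.pi_pos
  set f : ℝ → ℝ := fun z => 2 * Real.pi * z - c * cosExpIntegral 1 z with hf
  have hfc : Continuous f := by
    have := continuous_cosExpIntegral 1
    fun_prop
  -- The slope at `0` is `π (2 - c)`; this is where `c < 2` enters.
  have hd : HasDerivAt f (2 * Real.pi - c * Real.pi) 0 := by
    have h := ((hasDerivAt_id (0 : ℝ)).const_mul (2 * Real.pi)).sub
      ((hasDerivAt_cosExpIntegral 1 0).const_mul c)
    simp only [Nat.reduceAdd, cosExpIntegral_two_zero, mul_one] at h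
    exact h
  have hf0 : f 0 = 0 := by simp [hf, cosExpIntegral_one_zero]
  obtain ⟨a, ha, hfa⟩ : ∃ a : ℝ, 0 < a ∧ 0 < f a := by
    have hslope := (hasDerivAt_iff_tendsto_slope.1 hd).mono_left
      (nhdsWithin_mono (0 : ℝ)
      (show Set.Ioi (0 : ℝ) ⊆ {0}ᶜ from fun x hx => ne_of_gt hx))
    have hpos : 0 < 2 * Real.pi - c * Real.pi := by nlinarith
    obtain ⟨a, h1, h2⟩ := ((hslope.eventually (lt_mem_nhds hpos)).and self_mem_nhdsWithin).exists
    refine ⟨a, h2, ?_⟩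
    have h2' : (0 : ℝ) < a := h2
    rw [slope_def_field, hf0, sub_zero, sub_zero] at h1
    exact (div_pos_iff_of_pos_right h2').1 h1
  -- The summand `a` keeps `b` to the right of `a`; the rest gives `b ≥ 8` and `c b ≥ 32 + 8 c`,
  -- enough for the quadratic lower bound to beat `2π b`.
  set b : ℝ := a + (32 / c + 8) with hb
  have hb0 : 0 < b := by positivity
  have hfb : f b < 0 := by
    have h1 := mul_le_mul_of_nonneg_left (cosExpIntegral_one_lower_bound hb0.le) hc.le
    have h2 : 32 + 8 * c ≤ c * b := by
      have : c * b = c * a + (32 + 8 * c) := by rw [hb]; field_simp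
      have := mul_pos hc ha
      linarith
    have h4 : 8 ≤ b := by
      have : 0 ≤ 32 / c := by positivity
      linarith
    have h3 : 0 < c * (b ^ 2 / 4 * (3 / 4) - 2) - 2 * b := by
      nlinarith [mul_le_mul_of_nonneg_right h2 hb0.le]
    have h5 := mul_pos hπ h3
    simp only [hf]
    nlinarith
  obtain ⟨z, hz, hfz⟩ := intermediate_value_Icc' (f := f) (show a ≤ b by
    have : 0 ≤ 32 / c := by positivity
    linarith) hfc.continuousOn ⟨hfb.le, hfa.le⟩
  exact ⟨z, ha.trans_le hz.1, by simp only [hf] at hfz; linarith⟩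

/-! ### The action as a function of the energy -/

theorem modulus_sq {M h : ℝ} (hM : 0 < M) (hh : -M ≤ h) : modulus M h ^ 2 = (h + M) / (2 * M) :=
  Real.sq_sqrt (div_nonneg (by linarith) (by linarith))

theorem one_sub_mul_sin_sq_pos {u : ℝ} (hu : u < 1) (t : ℝ) : 0 < 1 - u * Real.sin t ^ 2 := by
  have h1 := Real.sin_sq_le_one t
  have h2 := mul_nonneg (sq_nonneg (Real.sin t)) (sub_nonneg.2 hu.le)
  rcases h1.lt_or_eq with h | h
  · linarith
  · rw [h]; linarith

theorem sub_sin_sq_pos {u : ℝ} (hu : 1 < u) (t : ℝ) : 0 < u - Real.sin t ^ 2 := by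
  have h1 := Real.sin_sq_le_one t
  linarith

theorem sqrt_one_sub_inv_sqrt {u : ℝ} (hu : 0 < u) (s : ℝ) :
    Real.sqrt (1 - (1 / Real.sqrt u) ^ 2 * s) = Real.sqrt (u - s) / Real.sqrt u := by
  rw [← Real.sqrt_div' _ hu.le, div_pow, Real.sq_sqrt hu.le]
  congr 1
  field_simp

/-- In the reduced energy `u = k²` the reciprocal modulus disappears and the parameter enters as a
shift under the root, which makes differentiation immediate. -/
theorem sqrt_mul_completeE_inv {u : ℝ} (hu : 0 < u) :
    Real.sqrt u * completeE (1 / Real.sqrt u)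
      = ∫ t in (0 : ℝ)..Real.pi / 2, Real.sqrt (u - Real.sin t ^ 2) := by
  have hu' := Real.sqrt_pos.2 hu
  rw [completeE, ellipticE, ← intervalIntegral.integral_const_mul]
  refine intervalIntegral.integral_congr fun t _ => ?_
  simp only [sqrt_one_sub_inv_sqrt hu]
  field_simp

theorem completeK_inv_div_sqrt {u : ℝ} (hu : 0 < u) :
    completeK (1 / Real.sqrt u) / Real.sqrt u
      = ∫ t in (0 : ℝ)..Real.pi / 2, 1 / Real.sqrt (u - Real.sin t ^ 2) := by
  have hu' := Real.sqrt_pos.2 hu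
  rw [completeK, ellipticF, ← intervalIntegral.integral_div]
  refine intervalIntegral.integral_congr fun t _ => ?_
  simp only [sqrt_one_sub_inv_sqrt hu]
  field_simp

theorem hasDerivAt_integral_sqrt_sub_sin_sq {u : ℝ} (hu : 1 < u) :
    HasDerivAt (fun u => ∫ t in (0 : ℝ)..Real.pi / 2, Real.sqrt (u - Real.sin t ^ 2))
      ((∫ t in (0 : ℝ)..Real.pi / 2, 1 / Real.sqrt (u - Real.sin t ^ 2)) / 2) u := by
  have h := hasDerivAt_intervalIntegral_param
    (p := fun u t => Real.sqrt (u - Real.sin t ^ 2))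
    (p' := fun u t => 1 / (2 * Real.sqrt (u - Real.sin t ^ 2))) (isOpen_Ioi (a := (1 : ℝ)))
    (by unfold Function.uncurry; fun_prop)
    (by
      unfold Function.uncurry
      refine ContinuousOn.div (by fun_prop) (by fun_prop) ?_
      rintro ⟨v, t⟩ ⟨hv, -⟩
      have := Real.sqrt_pos.2 (sub_sin_sq_pos hv t)
      positivity)
    (fun v hv t => by
      have h1 : HasDerivAt (fun v : ℝ => v - Real.sin t ^ 2) 1 v :=
        (hasDerivAt_id v).sub_const _
      exact h1.sqrt (sub_sin_sq_pos hv t).ne')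
    hu 0 (Real.pi / 2)
  refine h.congr_deriv ?_
  rw [← intervalIntegral.integral_div]
  refine intervalIntegral.integral_congr fun t _ => ?_
  have := Real.sqrt_pos.2 (sub_sin_sq_pos hu t)
  field_simp

theorem completeE_sqrt {u : ℝ} (hu : 0 ≤ u) :
    completeE (Real.sqrt u) = ∫ t in (0 : ℝ)..Real.pi / 2, Real.sqrt (1 - u * Real.sin t ^ 2) := by
  rw [completeE, ellipticE, Real.sq_sqrt hu]

theorem completeK_sqrt {u : ℝ} (hu : 0 ≤ u) : completeK (Real.sqrt u)
    = ∫ t in (0 : ℝ)..Real.pi / 2, 1 / Real.sqrt (1 - u * Real.sin t ^ 2) := by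
  rw [completeK, ellipticF, Real.sq_sqrt hu]

/-- This primitive vanishes at `0` and `π / 2`, so its derivative can be dropped from integrals over
that interval. -/
theorem hasDerivAt_sin_mul_cos_div {u : ℝ} (hu : u < 1) (t : ℝ) :
    HasDerivAt (fun t => Real.sin t * Real.cos t / Real.sqrt (1 - u * Real.sin t ^ 2))
      ((1 - 2 * Real.sin t ^ 2 + u * Real.sin t ^ 4)
        / ((1 - u * Real.sin t ^ 2) * Real.sqrt (1 - u * Real.sin t ^ 2))) t := by
  have hr := one_sub_mul_sin_sq_pos hu t
  have hs := Real.sqrt_pos.2 hr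
  have h1 : HasDerivAt (fun t => 1 - u * Real.sin t ^ 2)
      (-(u * (2 * Real.sin t * Real.cos t))) t := by
    refine ((((Real.hasDerivAt_sin t).pow 2).const_mul u).const_sub 1).congr_deriv ?_
    simp
  refine (((Real.hasDerivAt_sin t).mul (Real.hasDerivAt_cos t)).div (h1.sqrt hr.ne')
    hs.ne').congr_deriv ?_
  have hsq := Real.sq_sqrt hr.le
  have hc := Real.cos_sq' t
  simp only [Pi.mul_apply]
  set w := Real.sqrt (1 - u * Real.sin t ^ 2)
  rw [← hsq]
  field_simp
  have e : w ^ 2 = 1 - u * Real.sin t ^ 2 := hsq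
  rw [hc, e]
  ring

/-- This is `d/du (E - (1 - u) K) = K / 2`. The `u`-derivative of the integrand is half the
integrand of `K` plus half the `t`-derivative of `sin t cos t / √(1 - u sin² t)`, and the latter
integrates to zero. -/
theorem hasDerivAt_eye_integral {u : ℝ} (hu : u < 1) :
    HasDerivAt (fun u => ∫ t in (0 : ℝ)..Real.pi / 2, (Real.sqrt (1 - u * Real.sin t ^ 2)
        - (1 - u) * (1 / Real.sqrt (1 - u * Real.sin t ^ 2))))
      ((∫ t in (0 : ℝ)..Real.pi / 2, 1 / Real.sqrt (1 - u * Real.sin t ^ 2)) / 2) u := by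
  have hcont : Continuous fun t => 1 / Real.sqrt (1 - u * Real.sin t ^ 2) :=
    Continuous.div (by fun_prop) (by fun_prop)
      fun t => (Real.sqrt_pos.2 (one_sub_mul_sin_sq_pos hu t)).ne'
  have hcont' : Continuous fun t => (1 - 2 * Real.sin t ^ 2 + u * Real.sin t ^ 4)
      / ((1 - u * Real.sin t ^ 2) * Real.sqrt (1 - u * Real.sin t ^ 2)) := by
    refine Continuous.div (by fun_prop) (by fun_prop) fun t => ?_
    have h1 := one_sub_mul_sin_sq_pos hu t
    have := Real.sqrt_pos.2 h1
    positivity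
  have h := hasDerivAt_intervalIntegral_param
    (p := fun u t => Real.sqrt (1 - u * Real.sin t ^ 2)
        - (1 - u) * (1 / Real.sqrt (1 - u * Real.sin t ^ 2)))
    (p' := fun u t => 1 / Real.sqrt (1 - u * Real.sin t ^ 2) / 2
      + (1 - 2 * Real.sin t ^ 2 + u * Real.sin t ^ 4)
        / ((1 - u * Real.sin t ^ 2) * Real.sqrt (1 - u * Real.sin t ^ 2)) / 2)
    (isOpen_Iio (a := (1 : ℝ)))
    (by
      unfold Function.uncurry
      refine ContinuousOn.sub (by fun_prop) (ContinuousOn.mul (by fun_prop)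
        (ContinuousOn.div (by fun_prop) (by fun_prop) ?_))
      rintro ⟨v, t⟩ ⟨hv, -⟩
      exact (Real.sqrt_pos.2 (one_sub_mul_sin_sq_pos hv t)).ne')
    (by
      unfold Function.uncurry
      refine ContinuousOn.add (ContinuousOn.div_const (ContinuousOn.div (by fun_prop)
        (by fun_prop) ?_) _) (ContinuousOn.div_const (ContinuousOn.div (by fun_prop)
        (by fun_prop) ?_) _)
      · rintro ⟨v, t⟩ ⟨hv, -⟩
        exact (Real.sqrt_pos.2 (one_sub_mul_sin_sq_pos hv t)).ne'
      · rintro ⟨v, t⟩ ⟨hv, -⟩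
        have h1 := one_sub_mul_sin_sq_pos hv t
        exact (mul_pos h1 (Real.sqrt_pos.2 h1)).ne')
    (fun v hv t => by
      have hr := one_sub_mul_sin_sq_pos hv t
      have hs := Real.sqrt_pos.2 hr
      have h1 : HasDerivAt (fun v : ℝ => 1 - v * Real.sin t ^ 2) (-(1 * Real.sin t ^ 2)) v :=
        ((hasDerivAt_id v).mul_const _).const_sub 1
      have h2 := h1.sqrt hr.ne'
      have h3 : HasDerivAt (fun v : ℝ => 1 - v) (-1) v := (hasDerivAt_id v).const_sub 1
      refine (h2.sub (h3.mul ((hasDerivAt_const v (1 : ℝ)).div h2 hs.ne'))).congr_deriv ?_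
      have hsq := Real.sq_sqrt hr.le
      simp only [Pi.div_apply]
      set w := Real.sqrt (1 - v * Real.sin t ^ 2)
      rw [← hsq]
      field_simp
      have e : w ^ 2 = 1 - v * Real.sin t ^ 2 := hsq
      rw [e]
      ring)
    hu 0 (Real.pi / 2)
  refine h.congr_deriv ?_
  have hparts := intervalIntegral.integral_eq_sub_of_hasDerivAt (a := 0) (b := Real.pi / 2)
    (fun t _ => hasDerivAt_sin_mul_cos_div hu t) (hcont'.intervalIntegrable _ _)
  simp only [Real.sin_pi_div_two, Real.cos_pi_div_two, mul_zero, zero_div, Real.sin_zero,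
    zero_mul, sub_zero] at hparts
  rw [intervalIntegral.integral_add ((hcont.div_const 2).intervalIntegrable _ _)
    ((hcont'.div_const 2).intervalIntegrable _ _), intervalIntegral.integral_div,
    intervalIntegral.integral_div, hparts]
  simp

/-- The derivative `a_*'(h)` of the action. -/
def actionDeriv (M h : ℝ) : Chart → ℝ
  | .plus => completeK (1 / modulus M h) / (Real.pi * Real.sqrt M * modulus M h)
  | .minus => completeK (1 / modulus M h) / (Real.pi * Real.sqrt M * modulus M h)
  | .eye => 2 * completeK (modulus M h) / (Real.pi * Real.sqrt M)

theorem outerAction_eq {M h : ℝ} (hM : 0 < M) (hh : -M < h) : outerAction M h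
    = 4 / Real.pi * Real.sqrt M * ∫ t in (0 : ℝ)..Real.pi / 2,
        Real.sqrt ((h + M) / (2 * M) - Real.sin t ^ 2) := by
  have : 0 < (h + M) / (2 * M) := div_pos (by linarith) (by linarith)
  rw [← sqrt_mul_completeE_inv this, outerAction, modulus]
  ring

theorem eyeAction_eq {M h : ℝ} (hM : 0 < M) (h1 : -M ≤ h) (h2 : h < M) : eyeAction M h
    = 8 * Real.sqrt M / Real.pi * ∫ t in (0 : ℝ)..Real.pi / 2,
        (Real.sqrt (1 - (h + M) / (2 * M) * Real.sin t ^ 2) - (1 - (h + M) / (2 * M)) *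
          (1 / Real.sqrt (1 - (h + M) / (2 * M) * Real.sin t ^ 2))) := by
  have hu : 0 ≤ (h + M) / (2 * M) := div_nonneg (by linarith) (by linarith)
  have hu1 : (h + M) / (2 * M) < 1 := by rw [div_lt_one (by linarith)]; linarith
  have hcont : Continuous fun t => 1 / Real.sqrt (1 - (h + M) / (2 * M) * Real.sin t ^ 2) :=
    Continuous.div (by fun_prop) (by fun_prop)
      fun t => (Real.sqrt_pos.2 (one_sub_mul_sin_sq_pos hu1 t)).ne'
  rw [intervalIntegral.integral_sub (Continuous.intervalIntegrable (by fun_prop) _ _)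
    ((hcont.const_mul _).intervalIntegrable _ _), intervalIntegral.integral_const_mul,
    ← completeE_sqrt hu, ← completeK_sqrt hu, eyeAction, modulus_sq hM h1, modulus]

theorem completeK_pos {k : ℝ} (hk : k ^ 2 < 1) : 0 < completeK k := by
  have hcont : Continuous fun t => 1 / Real.sqrt (1 - k ^ 2 * Real.sin t ^ 2) :=
    Continuous.div (by fun_prop) (by fun_prop)
      fun t => (Real.sqrt_pos.2 (one_sub_mul_sin_sq_pos hk t)).ne'
  refine intervalIntegral.intervalIntegral_pos_of_pos (hcont.intervalIntegrable _ _)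
    (fun t => one_div_pos.2 (Real.sqrt_pos.2 (one_sub_mul_sin_sq_pos hk t)))
    (by linarith [Real.pi_pos])

theorem one_lt_of_outer {M h : ℝ} (hM : 0 < M) (hh : M < h) : 1 < (h + M) / (2 * M) := by
  rw [lt_div_iff₀ (by linarith)]; linarith

theorem lt_one_of_eye {M h : ℝ} (hM : 0 < M) (hh : h < M) : (h + M) / (2 * M) < 1 := by
  rw [div_lt_one (by linarith)]; linarith

theorem inv_modulus_sq_lt_one {M h : ℝ} (hM : 0 < M) (hh : M < h) :
    (1 / modulus M h) ^ 2 < 1 := by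
  have h1 := one_lt_of_outer hM hh
  rw [div_pow, modulus_sq hM (by linarith), one_pow]
  exact (div_lt_one (by linarith)).2 h1

theorem modulus_sq_lt_one {M h : ℝ} (hM : 0 < M) (h1 : -M ≤ h) (h2 : h < M) :
    modulus M h ^ 2 < 1 := by
  rw [modulus_sq hM h1]; exact lt_one_of_eye hM h2

theorem modulus_pos {M h : ℝ} (hM : 0 < M) (hh : -M < h) : 0 < modulus M h :=
  Real.sqrt_pos.2 (div_pos (by linarith) (by linarith))

theorem actionDeriv_pos {M h : ℝ} (hM : 0 < M) (c : Chart) (hh : h ∈ energyRange M c) :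
    0 < actionDeriv M h c := by
  have hs := Real.sqrt_pos.2 hM
  have hπ := Real.pi_pos
  rcases c with _ | _ | _
  · have hh' : M < h := hh
    have := completeK_pos (inv_modulus_sq_lt_one hM hh)
    have := modulus_pos hM (show -M < h by linarith)
    simp only [actionDeriv]; positivity
  · have hh' : M < h := hh
    have := completeK_pos (inv_modulus_sq_lt_one hM hh)
    have := modulus_pos hM (show -M < h by linarith)
    simp only [actionDeriv]; positivity
  · have := completeK_pos (modulus_sq_lt_one hM hh.1.le hh.2)
    simp only [actionDeriv]; positivity

theorem hasDerivAt_reduced_energy (M h : ℝ) :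
    HasDerivAt (fun h => (h + M) / (2 * M)) (1 / (2 * M)) h :=
  ((hasDerivAt_id h).add_const M).div_const (2 * M)

theorem hasDerivAt_outerAction {M h : ℝ} (hM : 0 < M) (hh : M < h) :
    HasDerivAt (outerAction M) (actionDeriv M h .plus) h := by
  have h1 := ((hasDerivAt_integral_sqrt_sub_sin_sq (one_lt_of_outer hM hh)).comp h
    (hasDerivAt_reduced_energy M h)).const_mul (4 / Real.pi * Real.sqrt M)
  have hu : 0 < (h + M) / (2 * M) := div_pos (by linarith) (by linarith)
  have hev : outerAction M =ᶠ[nhds h] fun h => 4 / Real.pi * Real.sqrt M *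
      ((fun u => ∫ t in (0 : ℝ)..Real.pi / 2, Real.sqrt (u - Real.sin t ^ 2)) ∘
        fun h => (h + M) / (2 * M)) h := by
    filter_upwards [lt_mem_nhds hh] with h' hh'
    exact outerAction_eq hM (by linarith)
  refine (h1.congr_of_eventuallyEq hev).congr_deriv ?_
  rw [← completeK_inv_div_sqrt hu, actionDeriv]
  have hs := Real.sqrt_pos.2 hM
  have hm := modulus_pos hM (show -M < h by linarith)
  have hMs := Real.sq_sqrt hM.le
  change _ * (completeK (1 / modulus M h) / modulus M h / 2 * (1 / (2 * M))) = _
  set w := Real.sqrt M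
  rw [← hMs]
  field_simp
  ring

theorem hasDerivAt_eyeAction {M h : ℝ} (hM : 0 < M) (hh1 : -M < h) (hh2 : h < M) :
    HasDerivAt (eyeAction M) (actionDeriv M h .eye) h := by
  have h1 := ((hasDerivAt_eye_integral (lt_one_of_eye hM hh2)).comp h
    (hasDerivAt_reduced_energy M h)).const_mul (8 * Real.sqrt M / Real.pi)
  have hu : 0 < (h + M) / (2 * M) := div_pos (by linarith) (by linarith)
  have hev : eyeAction M =ᶠ[nhds h] fun h => 8 * Real.sqrt M / Real.pi *
      ((fun u => ∫ t in (0 : ℝ)..Real.pi / 2, (Real.sqrt (1 - u * Real.sin t ^ 2)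
        - (1 - u) * (1 / Real.sqrt (1 - u * Real.sin t ^ 2)))) ∘
        fun h => (h + M) / (2 * M)) h := by
    filter_upwards [lt_mem_nhds hh1, gt_mem_nhds hh2] with h' hh1' hh2'
    exact eyeAction_eq hM hh1'.le hh2'
  refine (h1.congr_of_eventuallyEq hev).congr_deriv ?_
  rw [← completeK_sqrt hu.le, actionDeriv]
  have hs := Real.sqrt_pos.2 hM
  have hMs := Real.sq_sqrt hM.le
  change _ * (completeK (modulus M h) / 2 * (1 / (2 * M))) = _
  set w := Real.sqrt M
  rw [← hMs]
  field_simp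
  ring

theorem hasDerivAt_action {M h : ℝ} (hM : 0 < M) (c : Chart) (hh : h ∈ energyRange M c) :
    HasDerivAt (action M c) (actionDeriv M h c) h := by
  rcases c with _ | _ | _
  · exact hasDerivAt_outerAction hM hh
  · exact hasDerivAt_outerAction hM hh
  · exact hasDerivAt_eyeAction hM hh.1 hh.2

/-! ### Boundary values, monotonicity and range of the action -/

theorem outerAction_self {M : ℝ} (hM : 0 < M) :
    outerAction M M = 4 / Real.pi * Real.sqrt M := by
  rw [outerAction_eq hM (by linarith)]
  have h1 : (M + M) / (2 * M) = 1 := by field_simp; ring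
  have : ∫ t in (0 : ℝ)..Real.pi / 2, Real.sqrt (1 - Real.sin t ^ 2)
      = ∫ t in (0 : ℝ)..Real.pi / 2, Real.cos t := by
    refine intervalIntegral.integral_congr fun t ht => ?_
    rw [Set.uIcc_of_le (by linarith [Real.pi_pos])] at ht
    rw [← Real.cos_sq',
      Real.sqrt_sq (Real.cos_nonneg_of_mem_Icc ⟨by linarith [ht.1, Real.pi_pos], ht.2⟩)]
  rw [h1, this]
  simp

theorem continuousOn_outerAction {M : ℝ} (hM : 0 < M) :
    ContinuousOn (outerAction M) (Set.Ici M) := by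
  have : Continuous fun u : ℝ => ∫ t in (0 : ℝ)..Real.pi / 2, Real.sqrt (u - Real.sin t ^ 2) :=
    intervalIntegral.continuous_parametric_intervalIntegral_of_continuous'
      (by unfold Function.uncurry; fun_prop) _ _
  have h2 : Continuous fun h : ℝ => 4 / Real.pi * Real.sqrt M * ∫ t in (0 : ℝ)..Real.pi / 2,
      Real.sqrt ((h + M) / (2 * M) - Real.sin t ^ 2) :=
    (this.comp (by fun_prop : Continuous fun h : ℝ => (h + M) / (2 * M))).const_mul _
  exact h2.continuousOn.congr fun h hh =>
    outerAction_eq hM (by have : M ≤ h := hh; linarith)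

theorem strictMonoOn_outerAction {M : ℝ} (hM : 0 < M) :
    StrictMonoOn (outerAction M) (Set.Ici M) := by
  refine strictMonoOn_of_deriv_pos (convex_Ici M) (continuousOn_outerAction hM) fun h hh => ?_
  rw [interior_Ici] at hh
  rw [(hasDerivAt_outerAction hM hh).deriv]
  exact actionDeriv_pos hM .plus hh

theorem image_outerAction {M : ℝ} (hM : 0 < M) :
    outerAction M '' Set.Ioi M = Set.Ioi (4 / Real.pi * Real.sqrt M) := by
  have hs := Real.sqrt_pos.2 hM
  have hπ := Real.pi_pos
  apply Set.Subset.antisymm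
  · rintro _ ⟨h, hh, rfl⟩
    rw [← outerAction_self hM]
    exact strictMonoOn_outerAction hM Set.self_mem_Ici (Set.mem_Ici.2 (le_of_lt hh)) hh
  · intro a ha
    have ha' : 4 / Real.pi * Real.sqrt M < a := ha
    have ha0 : 0 < a := lt_trans (by positivity) ha'
    set r := a / Real.sqrt M with hr
    have hr0 : 0 < r := by positivity
    -- At this energy the reduced energy is `1 + r²`, so the integrand is at least `r` and the
    -- action is at least `2 a`.
    set b := M + 2 * M * r ^ 2 with hb
    have hMb : M < b := by rw [hb]; nlinarith [mul_pos hM (pow_pos hr0 2)]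
    have hub : (b + M) / (2 * M) = 1 + r ^ 2 := by rw [hb]; field_simp; ring
    have hab : a < outerAction M b := by
      rw [outerAction_eq hM (by linarith), hub]
      have hmono : ∫ t in (0 : ℝ)..Real.pi / 2, r
          ≤ ∫ t in (0 : ℝ)..Real.pi / 2, Real.sqrt (1 + r ^ 2 - Real.sin t ^ 2) := by
        refine intervalIntegral.integral_mono (by linarith) intervalIntegrable_const
          (Continuous.intervalIntegrable (by fun_prop) _ _) fun t => ?_
        refine Real.le_sqrt_of_sq_le ?_
        linarith [Real.sin_sq_le_one t]
      rw [intervalIntegral.integral_const, smul_eq_mul] at hmono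
      have h1 := mul_le_mul_of_nonneg_left hmono
        (show 0 ≤ 4 / Real.pi * Real.sqrt M by positivity)
      have h2 : 4 / Real.pi * Real.sqrt M * ((Real.pi / 2 - 0) * r) = 2 * a := by
        rw [hr]; field_simp; ring
      linarith
    obtain ⟨h, hh, rfl⟩ := intermediate_value_Ioo hMb.le
      ((continuousOn_outerAction hM).mono Set.Icc_subset_Ici_self)
      ⟨by rwa [outerAction_self hM], hab⟩
    exact ⟨h, hh.1, rfl⟩

theorem eyeAction_self {M : ℝ} (hM : 0 < M) :
    eyeAction M M = 8 / Real.pi * Real.sqrt M := by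
  have h1 : modulus M M = 1 := by
    rw [modulus, show (M + M) / (2 * M) = 1 by field_simp; ring, Real.sqrt_one]
  have : completeE 1 = ∫ t in (0 : ℝ)..Real.pi / 2, Real.cos t := by
    refine intervalIntegral.integral_congr fun t ht => ?_
    rw [Set.uIcc_of_le (by linarith [Real.pi_pos])] at ht
    rw [one_pow, one_mul, ← Real.cos_sq',
      Real.sqrt_sq (Real.cos_nonneg_of_mem_Icc ⟨by linarith [ht.1, Real.pi_pos], ht.2⟩)]
  -- At `k = 1` the factor `1 - k²` is zero, so the value assigned to the divergent integral `K(1)`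
  -- is immaterial.
  rw [eyeAction, h1, this]
  simp
  ring

theorem eyeAction_neg_self (M : ℝ) : eyeAction M (-M) = 0 := by
  have h1 : modulus M (-M) = 0 := by simp [modulus]
  rw [eyeAction, h1]
  simp [completeE, completeK, ellipticE, ellipticF]

/-- Bound the integrand of `K` by its value at `t = π / 2`. Although `K` diverges as `k → 1`, the
product then tends to `0`, which gives continuity of the eye action up to the separatrix. -/
theorem one_sub_sq_mul_completeK_le {k : ℝ} (hk : k ^ 2 < 1) :
    (1 - k ^ 2) * completeK k ≤ Real.sqrt (1 - k ^ 2) * (Real.pi / 2) := by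
  have hcont : Continuous fun t => 1 / Real.sqrt (1 - k ^ 2 * Real.sin t ^ 2) :=
    Continuous.div (by fun_prop) (by fun_prop)
      fun t => (Real.sqrt_pos.2 (one_sub_mul_sin_sq_pos hk t)).ne'
  have hq : 0 < 1 - k ^ 2 := by linarith
  have hs := Real.sqrt_pos.2 hq
  have h : completeK k ≤ ∫ t in (0 : ℝ)..Real.pi / 2, 1 / Real.sqrt (1 - k ^ 2) := by
    refine intervalIntegral.integral_mono (by linarith [Real.pi_pos])
      (hcont.intervalIntegrable _ _) intervalIntegrable_const fun t => ?_
    refine one_div_le_one_div_of_le hs (Real.sqrt_le_sqrt ?_)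
    nlinarith [Real.sin_sq_le_one t, sq_nonneg k]
  rw [intervalIntegral.integral_const, smul_eq_mul] at h
  refine (mul_le_mul_of_nonneg_left h hq.le).trans_eq ?_
  have := Real.sq_sqrt hq.le
  rw [sub_zero]
  field_simp
  rw [this]

theorem continuousOn_eyeAction {M : ℝ} (hM : 0 < M) :
    ContinuousOn (eyeAction M) (Set.Icc (-M) M) := by
  have hE : Continuous completeE :=
    intervalIntegral.continuous_parametric_intervalIntegral_of_continuous'
      (by unfold Function.uncurry; fun_prop) _ _
  have hmod : Continuous (modulus M) := by unfold modulus; fun_prop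
  have hK : ContinuousOn (fun h => (1 - modulus M h ^ 2) * completeK (modulus M h))
      (Set.Icc (-M) M) := by
    intro h hh
    rcases hh.2.lt_or_eq with hlt | rfl
    · refine ContinuousAt.continuousWithinAt ?_
      have hk := modulus_sq_lt_one hM hh.1 hlt
      have hKc : ContinuousAt completeK (modulus M h) := by
        have hU : IsOpen {k : ℝ | k ^ 2 < 1} := isOpen_lt (by fun_prop) (by fun_prop)
        have hd : ∀ k ∈ {k : ℝ | k ^ 2 < 1}, ∀ t, HasDerivAt
            (fun k => 1 / Real.sqrt (1 - k ^ 2 * Real.sin t ^ 2))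
            (k * Real.sin t ^ 2 / ((1 - k ^ 2 * Real.sin t ^ 2) *
              Real.sqrt (1 - k ^ 2 * Real.sin t ^ 2))) k := by
          intro k hk t
          have hr := one_sub_mul_sin_sq_pos hk t
          have hs := Real.sqrt_pos.2 hr
          have h1 : HasDerivAt (fun k : ℝ => 1 - k ^ 2 * Real.sin t ^ 2)
              (-(2 * k * Real.sin t ^ 2)) k := by
            refine ((((hasDerivAt_id k).pow 2).mul_const _).const_sub 1).congr_deriv ?_
            simp
          refine ((hasDerivAt_const k (1 : ℝ)).div (h1.sqrt hr.ne') hs.ne').congr_deriv ?_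
          rw [Real.sq_sqrt hr.le]
          field_simp
          ring
        refine (hasDerivAt_intervalIntegral_param hU ?_ ?_ hd hk 0 (Real.pi / 2)).continuousAt
        · unfold Function.uncurry
          refine ContinuousOn.div (by fun_prop) (by fun_prop) ?_
          rintro ⟨v, t⟩ ⟨hv, -⟩
          exact (Real.sqrt_pos.2 (one_sub_mul_sin_sq_pos hv t)).ne'
        · unfold Function.uncurry
          refine ContinuousOn.div (by fun_prop) (by fun_prop) ?_
          rintro ⟨v, t⟩ ⟨hv, -⟩
          have h1 := one_sub_mul_sin_sq_pos hv t
          exact (mul_pos h1 (Real.sqrt_pos.2 h1)).ne'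
      exact ((continuousAt_const.sub (hmod.continuousAt.pow 2))).mul
        (ContinuousAt.comp (f := modulus M) hKc hmod.continuousAt)
    -- At the separatrix differentiation is unavailable; `(1 - k²) K` is squeezed between `0` and
    -- `√(1 - k²) π / 2`.
    · have h1 : modulus h h = 1 := by
        rw [modulus, show (h + h) / (2 * h) = 1 by field_simp; ring, Real.sqrt_one]
      have hlim : Filter.Tendsto (fun x => Real.sqrt (1 - modulus h x ^ 2) * (Real.pi / 2))
          (nhdsWithin h (Set.Icc (-h) h)) (nhds 0) := by
        have hc : Continuous fun x => Real.sqrt (1 - modulus h x ^ 2) * (Real.pi / 2) := by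
          fun_prop
        have := hc.tendsto h
        simp only [h1, one_pow, sub_self, Real.sqrt_zero, zero_mul] at this
        exact this.mono_left nhdsWithin_le_nhds
      unfold ContinuousWithinAt
      simp only [h1, one_pow, sub_self, zero_mul]
      refine tendsto_of_tendsto_of_tendsto_of_le_of_le' tendsto_const_nhds hlim ?_ ?_
      · filter_upwards [self_mem_nhdsWithin] with x hx
        rcases hx.2.lt_or_eq with hlt | rfl
        · have hk := modulus_sq_lt_one hM hx.1 hlt
          exact mul_nonneg (by linarith) (completeK_pos hk).le
        · simp [h1]
      · filter_upwards [self_mem_nhdsWithin] with x hx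
        rcases hx.2.lt_or_eq with hlt | rfl
        · exact one_sub_sq_mul_completeK_le (modulus_sq_lt_one hM hx.1 hlt)
        · simp [h1]
  exact ContinuousOn.mul continuousOn_const
    ((hE.comp hmod).continuousOn.sub hK)

theorem strictMonoOn_eyeAction {M : ℝ} (hM : 0 < M) :
    StrictMonoOn (eyeAction M) (Set.Icc (-M) M) := by
  refine strictMonoOn_of_deriv_pos (convex_Icc _ _) (continuousOn_eyeAction hM) fun h hh => ?_
  rw [interior_Icc] at hh
  rw [(hasDerivAt_eyeAction hM hh.1 hh.2).deriv]
  exact actionDeriv_pos hM .eye hh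

theorem image_eyeAction {M : ℝ} (hM : 0 < M) :
    eyeAction M '' Set.Ioo (-M) M = Set.Ioo 0 (8 / Real.pi * Real.sqrt M) := by
  have hmono := strictMonoOn_eyeAction hM
  rw [← eyeAction_self hM, ← eyeAction_neg_self M]
  apply Set.Subset.antisymm
  · rintro _ ⟨h, hh, rfl⟩
    exact ⟨hmono ⟨le_rfl, by linarith⟩ ⟨hh.1.le, hh.2.le⟩ hh.1,
      hmono ⟨hh.1.le, hh.2.le⟩ ⟨by linarith, le_rfl⟩ hh.2⟩
  · exact intermediate_value_Ioo (by linarith) (continuousOn_eyeAction hM)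

theorem strictMonoOn_action {M : ℝ} (hM : 0 < M) (c : Chart) :
    StrictMonoOn (action M c) (energyRange M c) := by
  rcases c with _ | _ | _
  · exact (strictMonoOn_outerAction hM).mono Set.Ioi_subset_Ici_self
  · exact (strictMonoOn_outerAction hM).mono Set.Ioi_subset_Ici_self
  · exact (strictMonoOn_eyeAction hM).mono Set.Ioo_subset_Icc_self

theorem image_action {M : ℝ} (hM : 0 < M) (c : Chart) :
    action M c '' energyRange M c = actionRange M c := by
  rcases c with _ | _ | _
  · exact image_outerAction hM
  · exact image_outerAction hM
  · exact image_eyeAction hM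

theorem energyOfAction_action {M h : ℝ} (hM : 0 < M) (c : Chart) (hh : h ∈ energyRange M c) :
    energyOfAction M c (action M c h) = h :=
  (strictMonoOn_action hM c).injOn.leftInvOn_invFunOn hh

theorem measurableSet_energyRange (M : ℝ) (c : Chart) : MeasurableSet (energyRange M c) := by
  rcases c with _ | _ | _
  · exact measurableSet_Ioi
  · exact measurableSet_Ioi
  · exact measurableSet_Ioo

/-- Change of variables `a = a_*(h)` in integrals over the action. -/
theorem integral_actionRange {M : ℝ} (hM : 0 < M) (c : Chart) (f : ℝ → ℝ) :
    (IntegrableOn (fun a => f (energyOfAction M c a)) (actionRange M c)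
      ↔ IntegrableOn (fun h => actionDeriv M h c * f h) (energyRange M c)) ∧
    ∫ a in actionRange M c, f (energyOfAction M c a)
      = ∫ h in energyRange M c, actionDeriv M h c * f h := by
  have hm := measurableSet_energyRange M c
  have hd := fun h hh => (hasDerivAt_action hM c hh).hasDerivWithinAt (s := energyRange M c)
    (x := h)
  have hmono := (strictMonoOn_action hM c).monotoneOn
  have hcongr : Set.EqOn
      (fun h => actionDeriv M h c • f (energyOfAction M c (action M c h)))
      (fun h => actionDeriv M h c * f h) (energyRange M c) := fun h hh => by
    simp only [energyOfAction_action hM c hh, smul_eq_mul]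
  rw [← image_action hM c]
  constructor
  · rw [integrableOn_image_iff_integrableOn_deriv_smul_of_monotoneOn hm hd hmono]
    exact integrableOn_congr_fun hcongr hm
  · rw [integral_image_eq_integral_deriv_smul_of_monotoneOn hm hd hmono]
    exact setIntegral_congr_fun hm hcongr

/-! ### The Jacobi amplitude and angle averages -/

theorem continuous_ellipticF_integrand {k : ℝ} (hk : k ^ 2 < 1) :
    Continuous fun t => 1 / Real.sqrt (1 - k ^ 2 * Real.sin t ^ 2) :=
  Continuous.div (by fun_prop) (by fun_prop)
    fun t => (Real.sqrt_pos.2 (one_sub_mul_sin_sq_pos hk t)).ne'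

theorem hasDerivAt_ellipticF {k : ℝ} (hk : k ^ 2 < 1) (φ : ℝ) :
    HasDerivAt (fun φ => ellipticF φ k) (1 / Real.sqrt (1 - k ^ 2 * Real.sin φ ^ 2)) φ :=
  intervalIntegral.integral_hasDerivAt_right
    ((continuous_ellipticF_integrand hk).intervalIntegrable _ _)
    (continuous_ellipticF_integrand hk).stronglyMeasurable.stronglyMeasurableAtFilter
    (continuous_ellipticF_integrand hk).continuousAt

theorem jacobiAm_ellipticF {k : ℝ} (hk : k ^ 2 < 1) (φ : ℝ) :
    jacobiAm (ellipticF φ k) k = φ := by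
  have hmono : StrictMono fun φ => ellipticF φ k := strictMono_of_deriv_pos fun t => by
    rw [(hasDerivAt_ellipticF hk t).deriv]
    exact one_div_pos.2 (Real.sqrt_pos.2 (one_sub_mul_sin_sq_pos hk t))
  exact Function.leftInverse_invFun hmono.injective φ

/-- Substitution `u = F(φ, k)`, which `am` inverts. Monotonicity and differentiability of `F`
suffice, so `q` may be arbitrary. -/
theorem integral_comp_jacobiAm {k : ℝ} (hk : k ^ 2 < 1) {a b : ℝ} (hab : a ≤ b) (q : ℝ → ℝ) :
    ∫ u in ellipticF a k..ellipticF b k, q (jacobiAm u k)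
      = ∫ φ in a..b, q φ / Real.sqrt (1 - k ^ 2 * Real.sin φ ^ 2) := by
  have hpos : ∀ t, 0 < 1 / Real.sqrt (1 - k ^ 2 * Real.sin t ^ 2) := fun t =>
    one_div_pos.2 (Real.sqrt_pos.2 (one_sub_mul_sin_sq_pos hk t))
  have hmono : Monotone fun φ => ellipticF φ k := monotone_of_deriv_nonneg
    (fun t => (hasDerivAt_ellipticF hk t).differentiableAt) fun t => by
      rw [(hasDerivAt_ellipticF hk t).deriv]; exact (hpos t).le
  have h := integral_Icc_deriv_smul_of_deriv_nonneg (g := fun u => q (jacobiAm u k))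
    (fun t _ => (hasDerivAt_ellipticF hk t).continuousAt.continuousWithinAt)
    (fun t (_ : t ∈ Set.Ioo a b) => hasDerivAt_ellipticF hk t) (fun t _ => (hpos t).le) hab
  rw [intervalIntegral.integral_of_le hab, intervalIntegral.integral_of_le (hmono hab),
    ← integral_Icc_eq_integral_Ioc, ← integral_Icc_eq_integral_Ioc, ← h]
  refine integral_congr_ae (Filter.Eventually.of_forall fun t => ?_)
  simp only [jacobiAm_ellipticF hk, smul_eq_mul]
  ring

theorem integral_sin_sq_symm {p : ℝ → ℝ} (hp : Continuous fun t => p (Real.sin t ^ 2)) :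
    ∫ t in (-(Real.pi / 2))..Real.pi / 2, p (Real.sin t ^ 2)
      = 2 * ∫ t in (0 : ℝ)..Real.pi / 2, p (Real.sin t ^ 2) := by
  have h := intervalIntegral.integral_comp_neg (a := 0) (b := Real.pi / 2)
    (fun t => p (Real.sin t ^ 2))
  simp only [Real.sin_neg, neg_sq, neg_zero] at h
  rw [← intervalIntegral.integral_add_adjacent_intervals (b := 0) (hp.intervalIntegrable _ _)
    (hp.intervalIntegrable _ _), ← h]
  ring

theorem integral_sin_sq_period {p : ℝ → ℝ} (hp : Continuous fun t => p (Real.sin t ^ 2)) :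
    ∫ t in (-(Real.pi / 2))..3 * Real.pi / 2, p (Real.sin t ^ 2)
      = 2 * ∫ t in (-(Real.pi / 2))..Real.pi / 2, p (Real.sin t ^ 2) := by
  have h := intervalIntegral.integral_comp_add_right (a := -(Real.pi / 2)) (b := Real.pi / 2)
    (fun t => p (Real.sin t ^ 2)) Real.pi
  simp only [Real.sin_add_pi, neg_sq] at h
  rw [show -(Real.pi / 2) + Real.pi = Real.pi / 2 by ring,
    show Real.pi / 2 + Real.pi = 3 * Real.pi / 2 by ring] at h
  rw [← intervalIntegral.integral_add_adjacent_intervals (b := Real.pi / 2)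
    (hp.intervalIntegrable _ _) (hp.intervalIntegrable _ _), ← h]
  ring

theorem ellipticF_neg_pi_div_two {k : ℝ} (hk : k ^ 2 < 1) :
    ellipticF (-(Real.pi / 2)) k = -completeK k := by
  have h := integral_sin_sq_symm (p := fun s => 1 / Real.sqrt (1 - k ^ 2 * s))
    (continuous_ellipticF_integrand hk)
  rw [← intervalIntegral.integral_add_adjacent_intervals (b := 0)
    ((continuous_ellipticF_integrand hk).intervalIntegrable _ _)
    ((continuous_ellipticF_integrand hk).intervalIntegrable _ _),
    intervalIntegral.integral_symm] at h
  change -ellipticF (-(Real.pi / 2)) k + completeK k = 2 * completeK k at h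
  linarith

/-- In the eye the angle interval `(-π, π)` becomes the argument interval `(-K, 3K)`, that is,
amplitudes from `-π / 2` to `3π / 2`: one full oscillation. -/
theorem ellipticF_three_pi_div_two {k : ℝ} (hk : k ^ 2 < 1) :
    ellipticF (3 * Real.pi / 2) k = 3 * completeK k := by
  have h := integral_sin_sq_period (p := fun s => 1 / Real.sqrt (1 - k ^ 2 * s))
    (continuous_ellipticF_integrand hk)
  rw [integral_sin_sq_symm (p := fun s => 1 / Real.sqrt (1 - k ^ 2 * s))
    (continuous_ellipticF_integrand hk),
    ← intervalIntegral.integral_add_adjacent_intervals (b := 0)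
    ((continuous_ellipticF_integrand hk).intervalIntegrable _ _)
    ((continuous_ellipticF_integrand hk).intervalIntegrable _ _),
    intervalIntegral.integral_symm] at h
  change -ellipticF (-(Real.pi / 2)) k + ellipticF (3 * Real.pi / 2) k
    = 2 * (2 * completeK k) at h
  rw [ellipticF_neg_pi_div_two hk] at h
  linarith

/-- The density in the energy of the pushforward of `g (cos x) dx dv` from the chart. -/
def energyWeight (M : ℝ) (g : ℝ → ℝ) (h : ℝ) : Chart → ℝ
  | .plus => (2 * Real.pi * Real.sqrt M)⁻¹ * ∫ t in (-(Real.pi / 2))..Real.pi / 2,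
      g (1 - 2 * Real.sin t ^ 2) / Real.sqrt ((h + M) / (2 * M) - Real.sin t ^ 2)
  | .minus => (2 * Real.pi * Real.sqrt M)⁻¹ * ∫ t in (-(Real.pi / 2))..Real.pi / 2,
      g (1 - 2 * Real.sin t ^ 2) / Real.sqrt ((h + M) / (2 * M) - Real.sin t ^ 2)
  | .eye => (Real.pi * Real.sqrt M)⁻¹ * ∫ t in (-(Real.pi / 2))..Real.pi / 2,
      g (1 - 2 * ((h + M) / (2 * M)) * Real.sin t ^ 2)
        / Real.sqrt (1 - (h + M) / (2 * M) * Real.sin t ^ 2)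

/-- The mean of `cos x` over the orbit of energy `h`. -/
def cosMean (M : ℝ) (c : Chart) (h : ℝ) : ℝ :=
  1 / (2 * Real.pi) * ∫ θ in (-Real.pi)..Real.pi, Real.cos (position M c θ h)

theorem cosCoeff_eq_cosMean (M : ℝ) (c : Chart) (a : ℝ) :
    cosCoeff M c a = cosMean M c (energyOfAction M c a) := rfl

theorem continuous_outer_integrand {u : ℝ} (hu : 1 < u) {g : ℝ → ℝ} (hg : Continuous g) :
    Continuous fun t => g (1 - 2 * Real.sin t ^ 2) / Real.sqrt (u - Real.sin t ^ 2) :=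
  Continuous.div (by fun_prop) (by fun_prop)
    fun t => (Real.sqrt_pos.2 (sub_sin_sq_pos hu t)).ne'

theorem continuous_eye_integrand {u : ℝ} (hu : u < 1) {g : ℝ → ℝ} (hg : Continuous g) :
    Continuous fun t => g (1 - 2 * u * Real.sin t ^ 2) / Real.sqrt (1 - u * Real.sin t ^ 2) :=
  Continuous.div (by fun_prop) (by fun_prop)
    fun t => (Real.sqrt_pos.2 (one_sub_mul_sin_sq_pos hu t)).ne'

theorem energyWeight_one_plus {M h : ℝ} (hM : 0 < M) (hh : M < h) :
    energyWeight M (fun _ => 1) h .plus = actionDeriv M h .plus := by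
  have hu := one_lt_of_outer hM hh
  have h1 := integral_sin_sq_symm
    (p := fun s => 1 / Real.sqrt ((h + M) / (2 * M) - s))
    (continuous_outer_integrand hu (g := fun _ => 1) continuous_const)
  simp only [energyWeight, actionDeriv]
  rw [h1, ← completeK_inv_div_sqrt (by linarith)]
  change (2 * Real.pi * Real.sqrt M)⁻¹ * (2 * (completeK (1 / modulus M h) / modulus M h)) = _
  have hs := Real.sqrt_pos.2 hM
  have hm := modulus_pos hM (show -M < h by linarith)
  have hπ := Real.pi_pos
  field_simp

/-- Action-angle variables carry normalized phase volume to `dθ da / (2π)`, so the volume density in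
energy is `a'(h)`. Concretely, evenness in `t` reduces the weight to the complete integral `K`. -/
theorem energyWeight_one {M h : ℝ} (hM : 0 < M) (c : Chart) (hh : h ∈ energyRange M c) :
    energyWeight M (fun _ => 1) h c = actionDeriv M h c := by
  rcases c with _ | _ | _
  · exact energyWeight_one_plus hM hh
  · exact energyWeight_one_plus hM hh
  · have hu := lt_one_of_eye hM hh.2
    have h1 := integral_sin_sq_symm
      (p := fun s => 1 / Real.sqrt (1 - (h + M) / (2 * M) * s))
      (continuous_eye_integrand hu (g := fun _ => 1) continuous_const)
    simp only [energyWeight, actionDeriv]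
    rw [h1, ← completeK_sqrt (div_nonneg (by linarith [hh.1]) (by linarith))]
    change (Real.pi * Real.sqrt M)⁻¹ * (2 * completeK (modulus M h)) = _
    ring

theorem actionDeriv_mul_cosMean_plus {M h : ℝ} (hM : 0 < M) (hh : M < h) :
    actionDeriv M h .plus * cosMean M .plus h = energyWeight M id h .plus := by
  have hk := inv_modulus_sq_lt_one hM hh
  have hK := completeK_pos hk
  have hs := Real.sqrt_pos.2 hM
  have hm := modulus_pos hM (show -M < h by linarith)
  have hπ := Real.pi_pos
  have hu : 0 < (h + M) / (2 * M) := div_pos (by linarith) (by linarith)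
  have h1 := integral_comp_jacobiAm hk (a := -(Real.pi / 2)) (b := Real.pi / 2) (by linarith)
    (fun φ => Real.cos (2 * φ))
  rw [ellipticF_neg_pi_div_two hk, show ellipticF (Real.pi / 2) (1 / modulus M h)
    = completeK (1 / modulus M h) from rfl] at h1
  have h2 := intervalIntegral.integral_comp_mul_left (a := -Real.pi) (b := Real.pi)
    (c := 1 / Real.pi * completeK (1 / modulus M h))
    (fun u => Real.cos (2 * jacobiAm u (1 / modulus M h))) (by positivity)
  rw [show 1 / Real.pi * completeK (1 / modulus M h) * -Real.pi = -completeK (1 / modulus M h) by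
      field_simp,
    show 1 / Real.pi * completeK (1 / modulus M h) * Real.pi = completeK (1 / modulus M h) by
      field_simp, h1] at h2
  have h3 : ∫ t in (-(Real.pi / 2))..Real.pi / 2,
      Real.cos (2 * t) / Real.sqrt (1 - (1 / modulus M h) ^ 2 * Real.sin t ^ 2)
      = modulus M h * ∫ t in (-(Real.pi / 2))..Real.pi / 2,
        id (1 - 2 * Real.sin t ^ 2) / Real.sqrt ((h + M) / (2 * M) - Real.sin t ^ 2) := by
    rw [← intervalIntegral.integral_const_mul]
    refine intervalIntegral.integral_congr fun t _ => ?_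
    simp only [modulus, sqrt_one_sub_inv_sqrt hu, Real.cos_two_mul', Real.cos_sq', id]
    rw [div_div_eq_mul_div]
    ring
  simp only [cosMean, position, energyWeight, actionDeriv]
  rw [h2, h3, smul_eq_mul]
  generalize (∫ t in (-(Real.pi / 2))..Real.pi / 2,
    id (1 - 2 * Real.sin t ^ 2) / Real.sqrt ((h + M) / (2 * M) - Real.sin t ^ 2)) = I
  field_simp

theorem cosMean_minus (M h : ℝ) : cosMean M .minus h = cosMean M .plus h := by
  simp only [cosMean, position, Real.cos_neg]

theorem actionDeriv_mul_cosMean_eye {M h : ℝ} (hM : 0 < M) (hh1 : -M < h) (hh2 : h < M) :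
    actionDeriv M h .eye * cosMean M .eye h = energyWeight M id h .eye := by
  have hk := modulus_sq_lt_one hM hh1.le hh2
  have hK := completeK_pos hk
  have hs := Real.sqrt_pos.2 hM
  have hm := modulus_pos hM hh1
  have hπ := Real.pi_pos
  have hu := lt_one_of_eye hM hh2
  have hk2 := modulus_sq hM hh1.le
  have hcos : ∀ φ, Real.cos (2 * Real.arcsin (modulus M h * Real.sin φ))
      = 1 - 2 * ((h + M) / (2 * M)) * Real.sin φ ^ 2 := by
    intro φ
    have hle : (modulus M h * Real.sin φ) ^ 2 ≤ 1 := by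
      have := Real.sin_sq_le_one φ
      rw [mul_pow]
      nlinarith [sq_nonneg (Real.sin φ)]
    have hle' := abs_le.1 ((sq_le_one_iff_abs_le_one _).1 hle)
    rw [Real.cos_two_mul', Real.cos_sq', Real.sin_arcsin hle'.1 hle'.2, ← hk2]
    ring
  have h1 := integral_comp_jacobiAm hk (a := -(Real.pi / 2)) (b := 3 * Real.pi / 2) (by linarith)
    (fun φ => Real.cos (2 * Real.arcsin (modulus M h * Real.sin φ)))
  rw [ellipticF_neg_pi_div_two hk, ellipticF_three_pi_div_two hk] at h1
  have h2 := intervalIntegral.integral_comp_mul_add (a := -Real.pi) (b := Real.pi)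
    (c := 2 / Real.pi * completeK (modulus M h))
    (fun u => Real.cos (2 * Real.arcsin (modulus M h * Real.sin (jacobiAm u (modulus M h)))))
    (by positivity) (completeK (modulus M h))
  rw [show 2 / Real.pi * completeK (modulus M h) * -Real.pi + completeK (modulus M h)
      = -completeK (modulus M h) by field_simp; ring,
    show 2 / Real.pi * completeK (modulus M h) * Real.pi + completeK (modulus M h)
      = 3 * completeK (modulus M h) by field_simp; ring, h1] at h2
  simp only [hcos, hk2] at h2
  rw [integral_sin_sq_period (p := fun s => (1 - 2 * ((h + M) / (2 * M)) * s)
    / Real.sqrt (1 - (h + M) / (2 * M) * s)) (continuous_eye_integrand hu continuous_id)] at h2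
  have h3 : cosMean M .eye h = 1 / (2 * Real.pi) * ∫ θ in (-Real.pi)..Real.pi,
      Real.cos (2 * Real.arcsin (modulus M h * Real.sin (jacobiAm
        (2 / Real.pi * completeK (modulus M h) * θ + completeK (modulus M h)) (modulus M h)))) := by
    simp only [cosMean, position, jacobiSn]
    congr 1
    refine intervalIntegral.integral_congr fun θ _ => ?_
    have : 2 / Real.pi * completeK (modulus M h) * (θ + Real.pi / 2)
      = 2 / Real.pi * completeK (modulus M h) * θ + completeK (modulus M h) := by
      field_simp
    simp only [this]
  rw [h3]
  simp only [hcos]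
  rw [h2, smul_eq_mul]
  simp only [energyWeight, actionDeriv, id]
  field_simp

/-- The angle is proportional to time along the orbit. Changing variable from angle to amplitude
produces the same integrals as the energy density of `cos x`. -/
theorem actionDeriv_mul_cosMean {M h : ℝ} (hM : 0 < M) (c : Chart) (hh : h ∈ energyRange M c) :
    actionDeriv M h c * cosMean M c h = energyWeight M id h c := by
  rcases c with _ | _ | _
  · exact actionDeriv_mul_cosMean_plus hM hh
  · rw [cosMean_minus]; exact actionDeriv_mul_cosMean_plus hM hh
  · exact actionDeriv_mul_cosMean_eye hM hh.1 hh.2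

theorem abs_cosMean_le_one (M : ℝ) (c : Chart) (h : ℝ) : |cosMean M c h| ≤ 1 := by
  have hπ := Real.pi_pos
  have h1 := intervalIntegral.norm_integral_le_of_norm_le_const (a := -Real.pi) (b := Real.pi)
    (f := fun θ => Real.cos (position M c θ h)) (C := 1)
    (fun θ _ => Real.abs_cos_le_one _)
  rw [Real.norm_eq_abs, show |Real.pi - -Real.pi| = 2 * Real.pi by
    rw [abs_of_nonneg (by linarith)]; ring] at h1
  rw [cosMean, abs_mul, abs_of_pos (by positivity : 0 < 1 / (2 * Real.pi))]
  calc 1 / (2 * Real.pi) * _ ≤ 1 / (2 * Real.pi) * (1 * (2 * Real.pi)) := by gcongr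
    _ = 1 := by field_simp

/-! ### Phase space integrals of functions of the energy -/

theorem setLIntegral_eq_of_subset_of_eq_zero {s t : Set ℝ} (hs : MeasurableSet s)
    (ht : MeasurableSet t) (hst : s ⊆ t) {f : ℝ → ENNReal} (hf : ∀ x ∈ t, x ∉ s → f x = 0) :
    ∫⁻ x in t, f x = ∫⁻ x in s, f x := by
  rw [← lintegral_indicator ht, ← lintegral_indicator hs]
  congr 1
  ext x
  by_cases hxs : x ∈ s
  · simp [hxs, hst hxs]
  · by_cases hxt : x ∈ t
    · simp [hxs, hxt, hf x hxt hxs]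
    · simp [hxs, hxt]

theorem lintegral_eq_two_mul_of_even {q : ℝ → ENNReal} (hq : ∀ v, q (-v) = q v) :
    ∫⁻ v, q v = 2 * ∫⁻ v in Set.Ioi 0, q v := by
  have h1 := (Measure.measurePreserving_neg (volume : Measure ℝ)).setLIntegral_comp_emb
    (Homeomorph.neg ℝ).measurableEmbedding q (Set.Ioi 0)
  have h2 : (Neg.neg '' Set.Ioi (0 : ℝ)) = Set.Iio 0 := by simp
  have h3 : ∫⁻ v in Set.Ioi (0 : ℝ), q (-v) = ∫⁻ v in Set.Iio (0 : ℝ), q v := by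
    rw [← h2]; exact h1
  rw [← lintegral_add_compl q (measurableSet_Ioi (a := (0 : ℝ))), Set.compl_Ioi,
    ← restrict_Iio_eq_restrict_Iic, ← h3]
  simp only [hq]
  ring

/-- Change of variables from the velocity to the energy `h = v² / 2 - b`. -/
theorem lintegral_velocity_eq (b : ℝ) (q : ℝ → ENNReal) :
    ∫⁻ v, q (v ^ 2 / 2 - b)
      = 2 * ∫⁻ h, ENNReal.ofReal (1 / Real.sqrt (2 * (h + b))) * q h := by
  rw [lintegral_eq_two_mul_of_even (fun v => by rw [neg_sq])]
  congr 1
  have hd : ∀ h ∈ Set.Ioi (-b), HasDerivWithinAt (fun h => Real.sqrt (2 * (h + b)))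
      (1 / Real.sqrt (2 * (h + b))) (Set.Ioi (-b)) h := by
    intro h hh
    have hh' : -b < h := hh
    have h0 : 0 < 2 * (h + b) := by linarith
    have h1 : HasDerivAt (fun h : ℝ => 2 * (h + b)) (2 * 1) h :=
      ((hasDerivAt_id h).add_const b).const_mul 2
    refine ((h1.sqrt h0.ne').congr_deriv ?_).hasDerivWithinAt
    have := Real.sqrt_pos.2 h0
    field_simp
  have hmono : MonotoneOn (fun h => Real.sqrt (2 * (h + b))) (Set.Ioi (-b)) :=
    fun x _ y _ hxy => Real.sqrt_le_sqrt (by linarith)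
  have himg : (fun h => Real.sqrt (2 * (h + b))) '' Set.Ioi (-b) = Set.Ioi 0 := by
    ext v
    constructor
    · rintro ⟨h, hh, rfl⟩
      have hh' : -b < h := hh
      exact Real.sqrt_pos.2 (by linarith)
    · intro hv
      have hv' : 0 < v := hv
      refine ⟨v ^ 2 / 2 - b, ?_, ?_⟩
      · have := pow_pos hv' 2
        simp only [Set.mem_Ioi]; linarith
      · simp only
        rw [show 2 * (v ^ 2 / 2 - b + b) = v ^ 2 by ring, Real.sqrt_sq hv'.le]
  rw [← himg, lintegral_image_eq_lintegral_deriv_mul_of_monotoneOn measurableSet_Ioi hd hmono,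
    ← setLIntegral_univ fun h => ENNReal.ofReal (1 / Real.sqrt (2 * (h + b))) * q h,
    setLIntegral_eq_of_subset_of_eq_zero measurableSet_Ioi
      MeasurableSet.univ (Set.subset_univ (Set.Ioi (-b)))]
  · refine setLIntegral_congr_fun measurableSet_Ioi fun h hh => ?_
    have hh' : -b < h := hh
    rw [Real.sq_sqrt (by linarith : 0 ≤ 2 * (h + b))]
    congr 2
    ring
  -- Here the real square root is `0` and so is `1 / 0`; hence the weight vanishes below the
  -- potential energy and all energies may be included.
  · intro h _ hh
    have hh' : h ≤ -b := not_lt.1 hh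
    rw [Real.sqrt_eq_zero_of_nonpos (by linarith)]
    simp

theorem setLIntegral_ofReal_eq_intervalIntegral {a b : ℝ} (hab : a ≤ b) {p : ℝ → ℝ}
    (hp : Continuous p) (hp0 : ∀ t, 0 ≤ p t) :
    ∫⁻ t in Set.Ioo a b, ENNReal.ofReal (p t) = ENNReal.ofReal (∫ t in a..b, p t) := by
  rw [intervalIntegral.integral_of_le hab, ofReal_integral_eq_lintegral_ofReal
    ((hp.intervalIntegrable a b).1) (Filter.Eventually.of_forall hp0), restrict_Ioo_eq_restrict_Ioc]

theorem sqrt_two_mul_energy {M h : ℝ} (hM : 0 < M) (x : ℝ) :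
    Real.sqrt (2 * (h + M * Real.cos x))
      = 2 * Real.sqrt M * Real.sqrt ((h + M) / (2 * M) - Real.sin (x / 2) ^ 2) := by
  have h1 : Real.cos x = 1 - 2 * Real.sin (x / 2) ^ 2 := by
    rw [Real.sin_sq_eq_half_sub]
    ring_nf
  rw [h1, show 2 * (h + M * (1 - 2 * Real.sin (x / 2) ^ 2))
    = (2 : ℝ) ^ 2 * (M * ((h + M) / (2 * M) - Real.sin (x / 2) ^ 2)) by field_simp; ring,
    Real.sqrt_mul (by norm_num), Real.sqrt_mul hM.le, Real.sqrt_sq (by norm_num)]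
  ring

theorem lintegral_position_outer {M h : ℝ} (hM : 0 < M) (hh : M < h) {g : ℝ → ℝ}
    (hg : Continuous g) (hg0 : ∀ y ∈ Set.Icc (-1 : ℝ) 1, 0 ≤ g y) :
    ∫⁻ x in Set.Ioo (-Real.pi) Real.pi,
        ENNReal.ofReal (g (Real.cos x) / Real.sqrt (2 * (h + M * Real.cos x)))
      = ENNReal.ofReal (2 * Real.pi * energyWeight M g h .plus) := by
  have hπ := Real.pi_pos
  have hs := Real.sqrt_pos.2 hM
  have hu := one_lt_of_outer hM hh
  have hg1 : ∀ t, 0 ≤ g (1 - 2 * Real.sin t ^ 2) := fun t =>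
    hg0 _ ⟨by linarith [Real.sin_sq_le_one t], by linarith [sq_nonneg (Real.sin t)]⟩
  have himg : (fun t : ℝ => 2 * t) '' Set.Ioo (-(Real.pi / 2)) (Real.pi / 2)
      = Set.Ioo (-Real.pi) Real.pi := by
    rw [Set.image_mul_left_Ioo (by norm_num)]
    congr 1 <;> ring
  rw [← himg, lintegral_image_eq_lintegral_deriv_mul_of_monotoneOn (f' := fun _ => 2)
    measurableSet_Ioo (fun t _ => by
      simpa using ((hasDerivAt_id t).const_mul (2 : ℝ)).hasDerivWithinAt)
    (fun x _ y _ hxy => by simpa using hxy)]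
  have hc := continuous_outer_integrand hu hg
  have heq : ∀ t : ℝ, ENNReal.ofReal 2 * ENNReal.ofReal (g (Real.cos (2 * t))
      / Real.sqrt (2 * (h + M * Real.cos (2 * t)))) = ENNReal.ofReal ((Real.sqrt M)⁻¹ *
        (g (1 - 2 * Real.sin t ^ 2) / Real.sqrt ((h + M) / (2 * M) - Real.sin t ^ 2))) := by
    intro t
    have := Real.sqrt_pos.2 (sub_sin_sq_pos hu t)
    rw [← ENNReal.ofReal_mul (by norm_num), sqrt_two_mul_energy hM,
      show 2 * t / 2 = t by ring, Real.cos_two_mul', Real.cos_sq',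
      show 1 - Real.sin t ^ 2 - Real.sin t ^ 2 = 1 - 2 * Real.sin t ^ 2 by ring]
    congr 1
    field_simp
  simp only [heq]
  rw [setLIntegral_ofReal_eq_intervalIntegral (by linarith) (hc.const_mul _)
    (fun t => mul_nonneg (by positivity) (div_nonneg (hg1 t) (Real.sqrt_nonneg _))),
    intervalIntegral.integral_const_mul]
  congr 1
  simp only [energyWeight]
  generalize (∫ t in (-(Real.pi / 2))..Real.pi / 2, g (1 - 2 * Real.sin t ^ 2)
    / Real.sqrt ((h + M) / (2 * M) - Real.sin t ^ 2)) = I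
  field_simp

/-- The substitution `sin (x / 2) = k sin t` sends `(-π / 2, π / 2)` onto the positions strictly
between the turning points. Its Jacobian cancels the singularity of the inverse velocity there. -/
theorem lintegral_position_eye {M h : ℝ} (hM : 0 < M) (hh1 : -M < h) (hh2 : h < M) {g : ℝ → ℝ}
    (hg : Continuous g) (hg0 : ∀ y ∈ Set.Icc (-1 : ℝ) 1, 0 ≤ g y) :
    ∫⁻ x in Set.Ioo (-Real.pi) Real.pi,
        ENNReal.ofReal (g (Real.cos x) / Real.sqrt (2 * (h + M * Real.cos x)))
      = ENNReal.ofReal (Real.pi * energyWeight M g h .eye) := by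
  have hπ := Real.pi_pos
  have hs := Real.sqrt_pos.2 hM
  have hu := lt_one_of_eye hM hh2
  have hu0 : 0 < (h + M) / (2 * M) := div_pos (by linarith) (by linarith)
  have hk := modulus_sq_lt_one hM hh1.le hh2
  have hm := modulus_pos hM hh1
  have hk2 := modulus_sq hM hh1.le
  set k := modulus M h with hkdef
  have hk1 : k < 1 := by nlinarith
  have hg1 : ∀ t, 0 ≤ g (1 - 2 * ((h + M) / (2 * M)) * Real.sin t ^ 2) := fun t => by
    have h1 := Real.sin_sq_le_one t
    have h2 := sq_nonneg (Real.sin t)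
    exact hg0 _ ⟨by nlinarith, by nlinarith⟩
  have hlt : ∀ t, -1 < k * Real.sin t ∧ k * Real.sin t < 1 := fun t =>
    ⟨by nlinarith [Real.neg_one_le_sin t], by nlinarith [Real.sin_le_one t]⟩
  have hd : ∀ t ∈ Set.Ioo (-(Real.pi / 2)) (Real.pi / 2), HasDerivWithinAt
      (fun t => 2 * Real.arcsin (k * Real.sin t))
      (2 * (k * Real.cos t / Real.sqrt (1 - (k * Real.sin t) ^ 2)))
      (Set.Ioo (-(Real.pi / 2)) (Real.pi / 2)) t := by
    intro t _
    have h1 := (Real.hasDerivAt_arcsin (hlt t).1.ne' (hlt t).2.ne).comp t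
      ((Real.hasDerivAt_sin t).const_mul k)
    refine ((h1.const_mul 2).congr_deriv ?_).hasDerivWithinAt
    ring
  have hmono : MonotoneOn (fun t => 2 * Real.arcsin (k * Real.sin t))
      (Set.Ioo (-(Real.pi / 2)) (Real.pi / 2)) := by
    intro x hx y hy hxy
    have := Real.strictMonoOn_sin.monotoneOn (Set.Ioo_subset_Icc_self hx)
      (Set.Ioo_subset_Icc_self hy) hxy
    have := Real.monotone_arcsin (mul_le_mul_of_nonneg_left this hm.le)
    simp only
    linarith
  have himg : (fun t => 2 * Real.arcsin (k * Real.sin t)) '' Set.Ioo (-(Real.pi / 2)) (Real.pi / 2)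
      ⊆ Set.Ioo (-Real.pi) Real.pi := by
    rintro _ ⟨t, _, rfl⟩
    have h1 := Real.neg_pi_div_two_lt_arcsin.2 (hlt t).1
    have h2 := Real.arcsin_lt_pi_div_two.2 (hlt t).2
    exact ⟨by simp only; linarith, by simp only; linarith⟩
  have hmeas : MeasurableSet ((fun t => 2 * Real.arcsin (k * Real.sin t)) ''
      Set.Ioo (-(Real.pi / 2)) (Real.pi / 2)) :=
    measurableSet_Ioo.image_of_monotoneOn hmono
  rw [setLIntegral_eq_of_subset_of_eq_zero hmeas measurableSet_Ioo himg,
    lintegral_image_eq_lintegral_deriv_mul_of_monotoneOn measurableSet_Ioo hd hmono]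
  · have hc := continuous_eye_integrand hu hg
    have heq : Set.EqOn (fun t : ℝ =>
        ENNReal.ofReal (2 * (k * Real.cos t / Real.sqrt (1 - (k * Real.sin t) ^ 2))) *
        ENNReal.ofReal (g (Real.cos (2 * Real.arcsin (k * Real.sin t)))
        / Real.sqrt (2 * (h + M * Real.cos (2 * Real.arcsin (k * Real.sin t))))))
        (fun t => ENNReal.ofReal ((Real.sqrt M)⁻¹ *
          (g (1 - 2 * ((h + M) / (2 * M)) * Real.sin t ^ 2)
          / Real.sqrt (1 - (h + M) / (2 * M) * Real.sin t ^ 2))))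
        (Set.Ioo (-(Real.pi / 2)) (Real.pi / 2)) := by
      intro t ht
      have hpos := Real.sqrt_pos.2 (one_sub_mul_sin_sq_pos hu t)
      have hcos := Real.cos_pos_of_mem_Ioo ht
      simp only
      have e1 : (k * Real.sin t) ^ 2 = (h + M) / (2 * M) * Real.sin t ^ 2 := by
        rw [mul_pow, hk2]
      rw [← ENNReal.ofReal_mul (by positivity), sqrt_two_mul_energy hM,
        show 2 * Real.arcsin (k * Real.sin t) / 2 = Real.arcsin (k * Real.sin t) by ring,
        Real.cos_two_mul', Real.cos_sq', Real.sin_arcsin (hlt t).1.le (hlt t).2.le, e1,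
        show (h + M) / (2 * M) - (h + M) / (2 * M) * Real.sin t ^ 2 = (k * Real.cos t) ^ 2 by
          rw [mul_pow, hk2, Real.cos_sq']; ring,
        Real.sqrt_sq (by positivity),
        show 1 - (h + M) / (2 * M) * Real.sin t ^ 2 - (h + M) / (2 * M) * Real.sin t ^ 2
          = 1 - 2 * ((h + M) / (2 * M)) * Real.sin t ^ 2 by ring]
      congr 1
      generalize Real.sqrt (1 - (h + M) / (2 * M) * Real.sin t ^ 2) = D at hpos
      generalize g (1 - 2 * ((h + M) / (2 * M)) * Real.sin t ^ 2) = G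
      field_simp
    rw [setLIntegral_congr_fun measurableSet_Ioo heq,
      setLIntegral_ofReal_eq_intervalIntegral (by linarith) (hc.const_mul _)
      (fun t => mul_nonneg (by positivity) (div_nonneg (hg1 t) (Real.sqrt_nonneg _))),
      intervalIntegral.integral_const_mul]
    congr 1
    simp only [energyWeight]
    generalize (∫ t in (-(Real.pi / 2))..Real.pi / 2,
      g (1 - 2 * ((h + M) / (2 * M)) * Real.sin t ^ 2)
      / Real.sqrt (1 - (h + M) / (2 * M) * Real.sin t ^ 2)) = I
    field_simp
  -- Beyond the turning points the radicand is nonpositive and the quotient is `0` by convention;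
  -- otherwise `arcsin (sin (x / 2) / k)` would be a preimage of `x`.
  · intro x hx hxn
    have hnonpos : (h + M) / (2 * M) - Real.sin (x / 2) ^ 2 ≤ 0 := by
      by_contra hcon
      have h1 : Real.sin (x / 2) ^ 2 < k ^ 2 := by rw [hk2]; linarith
      have h2 := abs_lt.1 (abs_lt_of_sq_lt_sq h1 hm.le)
      refine hxn ⟨Real.arcsin (Real.sin (x / 2) / k), ⟨?_, ?_⟩, ?_⟩
      · exact Real.neg_pi_div_two_lt_arcsin.2 (by rw [lt_div_iff₀ hm]; linarith)
      · exact Real.arcsin_lt_pi_div_two.2 (by rw [div_lt_iff₀ hm]; linarith)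
      · simp only
        rw [Real.sin_arcsin (by rw [le_div_iff₀ hm]; linarith)
          (by rw [div_le_iff₀ hm]; linarith), mul_div_cancel₀ _ hm.ne',
          Real.arcsin_sin (by linarith [hx.1]) (by linarith [hx.2])]
        ring
    rw [sqrt_two_mul_energy hM, Real.sqrt_eq_zero_of_nonpos hnonpos]
    simp

theorem lintegral_position_below {M h : ℝ} (hM : 0 < M) (hh : h ≤ -M) (g : ℝ → ℝ) :
    ∫⁻ x in Set.Ioo (-Real.pi) Real.pi,
        ENNReal.ofReal (g (Real.cos x) / Real.sqrt (2 * (h + M * Real.cos x))) = 0 := by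
  have : ∀ x, ENNReal.ofReal (g (Real.cos x) / Real.sqrt (2 * (h + M * Real.cos x))) = 0 := by
    intro x
    rw [Real.sqrt_eq_zero_of_nonpos (by nlinarith [Real.cos_le_one x])]
    simp
  simp only [this, lintegral_zero]

theorem energyWeight_nonneg {M h : ℝ} (hM : 0 < M) {g : ℝ → ℝ}
    (hg0 : ∀ y ∈ Set.Icc (-1 : ℝ) 1, 0 ≤ g y) (c : Chart) (hh : h ∈ energyRange M c) :
    0 ≤ energyWeight M g h c := by
  have hπ := Real.pi_pos
  have hout : ∀ t, 0 ≤ g (1 - 2 * Real.sin t ^ 2) := fun t =>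
    hg0 _ ⟨by linarith [Real.sin_sq_le_one t], by linarith [sq_nonneg (Real.sin t)]⟩
  have hplus : 0 ≤ energyWeight M g h .plus :=
    mul_nonneg (by positivity) (intervalIntegral.integral_nonneg (by linarith)
      fun t _ => div_nonneg (hout t) (Real.sqrt_nonneg _))
  rcases c with _ | _ | _
  · exact hplus
  · exact hplus
  · have hu := lt_one_of_eye hM hh.2
    have hu0 : 0 < (h + M) / (2 * M) := div_pos (by linarith [hh.1]) (by linarith)
    refine mul_nonneg (by positivity) (intervalIntegral.integral_nonneg (by linarith)
      fun t _ => div_nonneg (hg0 _ ⟨?_, ?_⟩) (Real.sqrt_nonneg _))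
    · have h1 := Real.sin_sq_le_one t
      have h2 := sq_nonneg (Real.sin t)
      nlinarith
    · have h2 := sq_nonneg (Real.sin t)
      nlinarith

theorem measurable_intervalIntegral_param {p : ℝ → ℝ → ℝ} (hp : Measurable (Function.uncurry p))
    {a b : ℝ} (hab : a ≤ b) : Measurable fun h => ∫ t in a..b, p h t := by
  simp only [intervalIntegral.integral_of_le hab]
  exact (hp.stronglyMeasurable.integral_prod_right' (ν := volume.restrict (Set.Ioc a b))).measurable

theorem measurable_energyWeight (M : ℝ) {g : ℝ → ℝ} (hg : Continuous g) (c : Chart) :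
    Measurable fun h => energyWeight M g h c := by
  have hπ := Real.pi_pos
  have hgm := hg.measurable
  have hplus : Measurable fun h => energyWeight M g h .plus :=
    (measurable_intervalIntegral_param (by unfold Function.uncurry; fun_prop)
      (by linarith)).const_mul _
  rcases c with _ | _ | _
  · exact hplus
  · exact hplus
  · exact (measurable_intervalIntegral_param (by unfold Function.uncurry; fun_prop)
      (by linarith)).const_mul _

/-- Phase space integrals of `w(h₀) g(cos x)` as integrals over the energy in the three charts. -/
theorem lintegral_phaseMeasure_energy {M : ℝ} (hM : 0 < M) {g w : ℝ → ℝ} (hg : Continuous g)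
    (hg0 : ∀ y ∈ Set.Icc (-1 : ℝ) 1, 0 ≤ g y) (hw : Measurable w) (hw0 : ∀ s, 0 ≤ w s) :
    ∫⁻ p : ℝ × ℝ, ENNReal.ofReal (w (h0 M p.1 p.2) * g (Real.cos p.1)) ∂phaseMeasure
      = (∫⁻ h in energyRange M .plus, ENNReal.ofReal (energyWeight M g h .plus * w h))
        + (∫⁻ h in energyRange M .minus, ENNReal.ofReal (energyWeight M g h .minus * w h))
        + ∫⁻ h in energyRange M .eye, ENNReal.ofReal (energyWeight M g h .eye * w h) := by
  have hπ := Real.pi_pos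
  have hgm := hg.measurable
  have hgc : ∀ x, 0 ≤ g (Real.cos x) := fun x =>
    hg0 _ ⟨Real.neg_one_le_cos x, Real.cos_le_one x⟩
  have hm1 : Measurable fun p : ℝ × ℝ =>
      ENNReal.ofReal (w (h0 M p.1 p.2) * g (Real.cos p.1)) := by
    unfold h0; fun_prop
  have hm2 : Measurable (Function.uncurry fun (x h : ℝ) => ENNReal.ofReal (w h) *
      ENNReal.ofReal (g (Real.cos x) / Real.sqrt (2 * (h + M * Real.cos x)))) := by
    unfold Function.uncurry; fun_prop
  have hx : ∀ x, ∫⁻ v, ENNReal.ofReal (w (h0 M x v) * g (Real.cos x))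
      = 2 * ∫⁻ h, ENNReal.ofReal (w h) *
        ENNReal.ofReal (g (Real.cos x) / Real.sqrt (2 * (h + M * Real.cos x))) := by
    intro x
    have := lintegral_velocity_eq (M * Real.cos x)
      (fun h => ENNReal.ofReal (w h * g (Real.cos x)))
    refine this.trans ?_
    congr 1
    refine lintegral_congr fun h => ?_
    rw [← ENNReal.ofReal_mul (by positivity), ← ENNReal.ofReal_mul (hw0 h)]
    congr 1
    ring
  have hh : ∀ h, ∫⁻ x in Set.Ioo (-Real.pi) Real.pi, ENNReal.ofReal (w h) *
        ENNReal.ofReal (g (Real.cos x) / Real.sqrt (2 * (h + M * Real.cos x)))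
      = ENNReal.ofReal (w h) * ∫⁻ x in Set.Ioo (-Real.pi) Real.pi,
        ENNReal.ofReal (g (Real.cos x) / Real.sqrt (2 * (h + M * Real.cos x))) := fun h =>
    lintegral_const_mul _ (by fun_prop)
  -- Energies up to `-M` carry no mass, and the separatrix level `h = M` is a null set.
  have hsplit : ∀ A : ℝ → ENNReal, (∀ h, h ≤ -M → A h = 0) →
      ∫⁻ h, A h = (∫⁻ h in Set.Ioo (-M) M, A h) + ∫⁻ h in Set.Ioi M, A h := by
    intro A hA
    rw [restrict_Ioo_eq_restrict_Ioc, ← lintegral_union measurableSet_Ioi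
      (Set.disjoint_left.2 fun x hx hx' => not_lt.2 hx.2 hx'),
      Set.Ioc_union_Ioi_eq_Ioi (by linarith), ← setLIntegral_univ]
    exact setLIntegral_eq_of_subset_of_eq_zero measurableSet_Ioi MeasurableSet.univ
      (Set.subset_univ _) fun h _ hh => hA h (not_lt.1 hh)
  have hc : ∀ W w : ℝ, 0 ≤ W → ∀ a, 0 ≤ a → ENNReal.ofReal w * ENNReal.ofReal (a * W)
      = ENNReal.ofReal a * ENNReal.ofReal (W * w) := by
    intro W w hW a ha
    rw [mul_comm, ← ENNReal.ofReal_mul (by positivity), ← ENNReal.ofReal_mul ha]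
    congr 1
    ring
  have houter : ∫⁻ h in Set.Ioi M, ENNReal.ofReal (w h) *
      ∫⁻ x in Set.Ioo (-Real.pi) Real.pi,
        ENNReal.ofReal (g (Real.cos x) / Real.sqrt (2 * (h + M * Real.cos x)))
      = ENNReal.ofReal (2 * Real.pi) *
        ∫⁻ h in Set.Ioi M, ENNReal.ofReal (energyWeight M g h .plus * w h) := by
    rw [← lintegral_const_mul' _ _ ENNReal.ofReal_ne_top]
    refine setLIntegral_congr_fun measurableSet_Ioi fun h hh => ?_
    rw [lintegral_position_outer hM hh hg hg0]
    exact hc _ _ (energyWeight_nonneg hM hg0 .plus hh) _ (by positivity)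
  have heye : ∫⁻ h in Set.Ioo (-M) M, ENNReal.ofReal (w h) *
      ∫⁻ x in Set.Ioo (-Real.pi) Real.pi,
        ENNReal.ofReal (g (Real.cos x) / Real.sqrt (2 * (h + M * Real.cos x)))
      = ENNReal.ofReal Real.pi *
        ∫⁻ h in Set.Ioo (-M) M, ENNReal.ofReal (energyWeight M g h .eye * w h) := by
    rw [← lintegral_const_mul' _ _ ENNReal.ofReal_ne_top]
    refine setLIntegral_congr_fun measurableSet_Ioo fun h hh => ?_
    rw [lintegral_position_eye hM hh.1 hh.2 hg hg0]
    exact hc _ _ (energyWeight_nonneg hM hg0 .eye hh) _ (by positivity)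
  have htorus : torusMeasure
      = ENNReal.ofReal (2 * Real.pi)⁻¹ • volume.restrict (Set.Ioo (-Real.pi) Real.pi) := by
    rw [torusMeasure, restrict_Ioo_eq_restrict_Ioc]
  rw [phaseMeasure, lintegral_prod _ hm1.aemeasurable]
  simp only [hx]
  rw [htorus, lintegral_smul_measure, lintegral_const_mul' _ _ (by norm_num),
    lintegral_lintegral_swap hm2.aemeasurable]
  simp only [hh]
  rw [hsplit _ (fun h hh => by rw [lintegral_position_below hM hh, mul_zero]), houter, heye]
  change _ = (∫⁻ h in Set.Ioi M, ENNReal.ofReal (energyWeight M g h .plus * w h))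
    + (∫⁻ h in Set.Ioi M, ENNReal.ofReal (energyWeight M g h .plus * w h))
    + ∫⁻ h in Set.Ioo (-M) M, ENNReal.ofReal (energyWeight M g h .eye * w h)
  generalize (∫⁻ h in Set.Ioi M, ENNReal.ofReal (energyWeight M g h .plus * w h)) = X
  generalize (∫⁻ h in Set.Ioo (-M) M, ENNReal.ofReal (energyWeight M g h .eye * w h)) = Y
  rw [smul_eq_mul]
  -- The `2` counts both signs of `v`. The outer position integral is `2π` times the weight of one
  -- chart, hence the two copies of `X`; the eye integral is `π` times its weight.
  have e1 : ENNReal.ofReal (2 * Real.pi)⁻¹ * 2 * ENNReal.ofReal Real.pi = 1 := by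
    rw [show (2 : ENNReal) = ENNReal.ofReal 2 by simp, ← ENNReal.ofReal_mul (by positivity),
      ← ENNReal.ofReal_mul (by positivity), ← ENNReal.ofReal_one]
    congr 1
    field_simp
  have e2 : ENNReal.ofReal (2 * Real.pi) = 2 * ENNReal.ofReal Real.pi := by
    rw [ENNReal.ofReal_mul (by norm_num)]; simp
  rw [e2]
  calc _ = ENNReal.ofReal (2 * Real.pi)⁻¹ * 2 * ENNReal.ofReal Real.pi * (X + X + Y) := by ring
    _ = _ := by rw [e1, one_mul]

/-! ### The Maxwell-Boltzmann state -/

theorem maxwellBoltzmann_pos {α : ℝ} (hα : 0 < α) (β s : ℝ) : 0 < maxwellBoltzmann α β s :=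
  mul_pos hα (Real.exp_pos _)

theorem hasDerivAt_maxwellBoltzmann (α β s : ℝ) :
    HasDerivAt (maxwellBoltzmann α β) (-β * maxwellBoltzmann α β s) s := by
  have h : HasDerivAt (fun s : ℝ => -β * s) (-β) s := by
    simpa using (hasDerivAt_id s).const_mul (-β)
  refine (h.exp.const_mul α).congr_deriv ?_
  unfold maxwellBoltzmann
  ring

theorem continuous_maxwellBoltzmann (α β : ℝ) : Continuous (maxwellBoltzmann α β) := by
  unfold maxwellBoltzmann; fun_prop

theorem state_maxwellBoltzmann (α β M x v : ℝ) : state (maxwellBoltzmann α β) M x v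
    = α * Real.exp (β * M * Real.cos x) * Real.exp (-(β / 2) * v ^ 2) := by
  rw [state, maxwellBoltzmann, h0, mul_assoc, ← Real.exp_add]
  congr 2
  ring

theorem integrable_torusMeasure {q : ℝ → ℝ} (hq : Continuous q) : Integrable q torusMeasure := by
  have : Integrable q (volume.restrict (Set.Ioc (-Real.pi) Real.pi)) :=
    (hq.intervalIntegrable (-Real.pi) Real.pi).1
  exact this.smul_measure ENNReal.ofReal_ne_top

theorem integral_torusMeasure (q : ℝ → ℝ) :
    ∫ x, q x ∂torusMeasure = (2 * Real.pi)⁻¹ * ∫ x in (-Real.pi)..Real.pi, q x := by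
  have hπ := Real.pi_pos
  rw [torusMeasure, integral_smul_measure, intervalIntegral.integral_of_le (by linarith),
    ENNReal.toReal_ofReal (by positivity), smul_eq_mul]

instance : SFinite torusMeasure := by unfold torusMeasure; infer_instance

theorem integrable_mul_state {β : ℝ} (hβ : 0 < β) (α M : ℝ) {q : ℝ → ℝ} (hq : Continuous q) :
    Integrable (fun p : ℝ × ℝ => q p.1 * state (maxwellBoltzmann α β) M p.1 p.2)
      phaseMeasure := by
  have h1 : Integrable (fun x => α * (q x * Real.exp (β * M * Real.cos x))) torusMeasure :=
    integrable_torusMeasure (by fun_prop)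
  have h2 := integrable_exp_neg_mul_sq (half_pos hβ)
  refine (h1.mul_prod h2).congr (Filter.Eventually.of_forall fun p => ?_)
  simp only [state_maxwellBoltzmann]
  ring

theorem integral_mul_state (α β M : ℝ) (q : ℝ → ℝ) :
    ∫ p : ℝ × ℝ, q p.1 * state (maxwellBoltzmann α β) M p.1 p.2 ∂phaseMeasure
      = α * Real.sqrt (Real.pi / (β / 2)) * (2 * Real.pi)⁻¹
        * ∫ x in (-Real.pi)..Real.pi, q x * Real.exp (β * M * Real.cos x) := by
  have h := integral_prod_mul (μ := torusMeasure) (ν := volume)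
    (fun x => α * (q x * Real.exp (β * M * Real.cos x))) (fun v => Real.exp (-(β / 2) * v ^ 2))
  rw [integral_gaussian, integral_torusMeasure, intervalIntegral.integral_const_mul] at h
  rw [phaseMeasure]
  refine Eq.trans (integral_congr_ae (Filter.Eventually.of_forall fun p => ?_)) (h.trans ?_)
  · simp only [state_maxwellBoltzmann]
    ring
  · ring

theorem integral_cos_pow_mul_state (α β M : ℝ) (n : ℕ) :
    ∫ p : ℝ × ℝ, Real.cos p.1 ^ n * state (maxwellBoltzmann α β) M p.1 p.2 ∂phaseMeasure
      = α * Real.sqrt (Real.pi / (β / 2)) * (2 * Real.pi)⁻¹ * cosExpIntegral n (β * M) :=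
  integral_mul_state α β M fun x => Real.cos x ^ n

theorem integral_sin_mul_state (α β M : ℝ) :
    ∫ p : ℝ × ℝ, Real.sin p.1 * state (maxwellBoltzmann α β) M p.1 p.2 ∂phaseMeasure = 0 := by
  have h := intervalIntegral.integral_comp_neg (a := -Real.pi) (b := Real.pi)
    (fun x => Real.sin x * Real.exp (β * M * Real.cos x))
  simp only [Real.sin_neg, Real.cos_neg, neg_mul, intervalIntegral.integral_neg, neg_neg] at h
  rw [integral_mul_state α β M Real.sin, show ∫ x in (-Real.pi)..Real.pi,
    Real.sin x * Real.exp (β * M * Real.cos x) = 0 by linarith, mul_zero]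

/-- Expand `cos (x - y)`: the sine moment of `η` vanishes by oddness and the cosine moment is `M` by
self-consistency. -/
theorem hamiltonian_state {α β M : ℝ} (hβ : 0 < β)
    (hM : SelfConsistent (maxwellBoltzmann α β) M) :
    hamiltonian (state (maxwellBoltzmann α β) M) = h0 M := by
  ext x v
  have hc := (integrable_mul_state hβ α M Real.continuous_cos).const_mul (Real.cos x)
  have hs := (integrable_mul_state hβ α M Real.continuous_sin).const_mul (Real.sin x)
  have hpot : potential (state (maxwellBoltzmann α β) M) x = Real.cos x * M := by
    have h1 := integral_add hc hs
    rw [integral_const_mul, integral_const_mul, integral_sin_mul_state, ← hM.2, mul_zero,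
      add_zero] at h1
    rw [potential, ← h1]
    refine integral_congr_ae (Filter.Eventually.of_forall fun p => ?_)
    simp only [Real.cos_sub]
    ring
  rw [hamiltonian, hpot, h0]
  ring

theorem isStationarySolution_state {α β M : ℝ} (hβ : 0 < β)
    (hM : SelfConsistent (maxwellBoltzmann α β) M) :
    IsStationarySolution (state (maxwellBoltzmann α β) M) where
  contDiff := by
    unfold state maxwellBoltzmann h0
    fun_prop
  periodic x v := by simp only [state, h0, Real.cos_add_two_pi]
  integrable := by
    simpa using integrable_mul_state hβ α M (q := fun _ => 1) continuous_const
  bracket_eq_zero x v := by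
    rw [hamiltonian_state hβ hM, poissonBracket]
    have hx : HasDerivAt (fun y => h0 M y v) (M * Real.sin x) x := by
      refine (((Real.hasDerivAt_cos x).const_mul M).const_sub (v ^ 2 / 2)).congr_deriv ?_
      ring
    have hv : HasDerivAt (fun w => h0 M x w) v v := by
      refine ((((hasDerivAt_id v).pow 2).div_const 2).sub_const (M * Real.cos x)).congr_deriv ?_
      simp
    have hG := hasDerivAt_maxwellBoltzmann α β (h0 M x v)
    have hGx : HasDerivAt (fun y => state (maxwellBoltzmann α β) M y v) _ x := hG.comp x hx
    have hGv : HasDerivAt (fun w => state (maxwellBoltzmann α β) M x w) _ v := hG.comp v hv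
    rw [hx.deriv, hv.deriv, hGx.deriv, hGv.deriv]
    ring

/-! ### Energy integrals of the Maxwell-Boltzmann profile -/

/-- For nonnegative `g` the Tonelli identity has a finite total, which forces each chart's integral
to be finite and allows passage to real integrals. -/
theorem energy_integrals {α β M : ℝ} (hα : 0 < α) (hβ : 0 < β) (hM : 0 < M) {g : ℝ → ℝ}
    (hg : Continuous g) (hg0 : ∀ y ∈ Set.Icc (-1 : ℝ) 1, 0 ≤ g y) :
    (∀ c, IntegrableOn (fun h => energyWeight M g h c * maxwellBoltzmann α β h)
      (energyRange M c)) ∧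
    ∫ p : ℝ × ℝ, g (Real.cos p.1) * state (maxwellBoltzmann α β) M p.1 p.2 ∂phaseMeasure
      = (∫ h in energyRange M .plus, energyWeight M g h .plus * maxwellBoltzmann α β h)
        + (∫ h in energyRange M .minus, energyWeight M g h .minus * maxwellBoltzmann α β h)
        + ∫ h in energyRange M .eye, energyWeight M g h .eye * maxwellBoltzmann α β h := by
  have hint := integrable_mul_state hβ α M (q := fun x => g (Real.cos x)) (by fun_prop)
  have hpos : ∀ p : ℝ × ℝ, 0 ≤ g (Real.cos p.1) * state (maxwellBoltzmann α β) M p.1 p.2 :=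
    fun p => mul_nonneg (hg0 _ ⟨Real.neg_one_le_cos _, Real.cos_le_one _⟩)
      (maxwellBoltzmann_pos hα β _).le
  have hkey := lintegral_phaseMeasure_energy hM hg hg0
    (continuous_maxwellBoltzmann α β).measurable fun s => (maxwellBoltzmann_pos hα β s).le
  have hL : ∫⁻ p : ℝ × ℝ, ENNReal.ofReal (maxwellBoltzmann α β (h0 M p.1 p.2)
      * g (Real.cos p.1)) ∂phaseMeasure = ENNReal.ofReal (∫ p : ℝ × ℝ, g (Real.cos p.1) *
        state (maxwellBoltzmann α β) M p.1 p.2 ∂phaseMeasure) := by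
    rw [ofReal_integral_eq_lintegral_ofReal hint (Filter.Eventually.of_forall hpos)]
    simp only [state, mul_comm]
  rw [hL] at hkey
  have hmeas : ∀ c, Measurable fun h => energyWeight M g h c * maxwellBoltzmann α β h := fun c =>
    (measurable_energyWeight M hg c).mul (continuous_maxwellBoltzmann α β).measurable
  have hnn : ∀ c, 0 ≤ᵐ[volume.restrict (energyRange M c)]
      fun h => energyWeight M g h c * maxwellBoltzmann α β h := fun c =>
    ae_restrict_of_forall_mem (measurableSet_energyRange M c) fun h hh =>
      mul_nonneg (energyWeight_nonneg hM hg0 c hh) (maxwellBoltzmann_pos hα β h).le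
  have hfin : ∀ c, ∫⁻ h in energyRange M c,
      ENNReal.ofReal (energyWeight M g h c * maxwellBoltzmann α β h) ≠ ⊤ := by
    have htop : (ENNReal.ofReal (∫ p : ℝ × ℝ, g (Real.cos p.1) *
        state (maxwellBoltzmann α β) M p.1 p.2 ∂phaseMeasure)) ≠ ⊤ := ENNReal.ofReal_ne_top
    rw [hkey, ENNReal.add_ne_top, ENNReal.add_ne_top] at htop
    rintro (_ | _ | _)
    · exact htop.1.1
    · exact htop.1.2
    · exact htop.2
  have hI : ∀ c, IntegrableOn (fun h => energyWeight M g h c * maxwellBoltzmann α β h)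
      (energyRange M c) := fun c =>
    (lintegral_ofReal_ne_top_iff_integrable (hmeas c).aestronglyMeasurable (hnn c)).1 (hfin c)
  refine ⟨hI, ?_⟩
  rw [← ofReal_integral_eq_lintegral_ofReal (hI .plus) (hnn .plus),
    ← ofReal_integral_eq_lintegral_ofReal (hI .minus) (hnn .minus),
    ← ofReal_integral_eq_lintegral_ofReal (hI .eye) (hnn .eye),
    ← ENNReal.ofReal_add (integral_nonneg_of_ae (hnn _)) (integral_nonneg_of_ae (hnn _)),
    ← ENNReal.ofReal_add (add_nonneg (integral_nonneg_of_ae (hnn _))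
      (integral_nonneg_of_ae (hnn _))) (integral_nonneg_of_ae (hnn _))] at hkey
  exact (ENNReal.ofReal_eq_ofReal_iff (integral_nonneg hpos)
    (add_nonneg (add_nonneg (integral_nonneg_of_ae (hnn _))
      (integral_nonneg_of_ae (hnn _))) (integral_nonneg_of_ae (hnn _)))).1 hkey

/-! ### Lower bound for the action integrals of the squared mean -/

/-- The identities above need a nonnegative weight, so `cos x` is handled as `(1 + cos x) - 1`. -/
theorem energyWeight_one_add_id {M h : ℝ} (hM : 0 < M) (c : Chart) (hh : h ∈ energyRange M c) :
    energyWeight M (fun y => 1 + y) h c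
      = energyWeight M (fun _ => 1) h c + energyWeight M id h c := by
  have hout : M < h → energyWeight M (fun y => 1 + y) h .plus
      = energyWeight M (fun _ => 1) h .plus + energyWeight M id h .plus := by
    intro hh
    have hu := one_lt_of_outer hM hh
    simp only [energyWeight]
    rw [← mul_add, ← intervalIntegral.integral_add
      ((continuous_outer_integrand hu (g := fun _ => 1) continuous_const).intervalIntegrable _ _)
      ((continuous_outer_integrand hu continuous_id).intervalIntegrable _ _)]
    simp only [add_div, id]
  rcases c with _ | _ | _
  · exact hout hh
  · exact hout hh
  · have hu := lt_one_of_eye hM hh.2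
    simp only [energyWeight]
    rw [← mul_add, ← intervalIntegral.integral_add
      ((continuous_eye_integrand hu (g := fun _ => 1) continuous_const).intervalIntegrable _ _)
      ((continuous_eye_integrand hu continuous_id).intervalIntegrable _ _)]
    simp only [add_div, id]

theorem integrableOn_actionDeriv_mul_cosMean_sq {α β M : ℝ} (hα : 0 < α) (hβ : 0 < β)
    (hM : 0 < M) (c : Chart) :
    IntegrableOn (fun h => actionDeriv M h c * (maxwellBoltzmann α β h * cosMean M c h ^ 2))
      (energyRange M c) := by
  have hI := (energy_integrals hα hβ hM (g := fun _ => 1) continuous_const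
    fun _ _ => zero_le_one).1 c
  -- Measurability of the mean comes from writing it as a quotient of two weights; integrability
  -- follows from `|C₀| ≤ 1`.
  have hmeas : Measurable fun h => energyWeight M (fun _ => 1) h c * (maxwellBoltzmann α β h
      * (energyWeight M id h c / energyWeight M (fun _ => 1) h c) ^ 2) :=
    (measurable_energyWeight M continuous_const c).mul
      ((continuous_maxwellBoltzmann α β).measurable.mul
        (((measurable_energyWeight M continuous_id c).div
          (measurable_energyWeight M continuous_const c)).pow_const 2))
  have hEq : Set.EqOn (fun h => energyWeight M (fun _ => 1) h c * (maxwellBoltzmann α β h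
      * (energyWeight M id h c / energyWeight M (fun _ => 1) h c) ^ 2))
      (fun h => actionDeriv M h c * (maxwellBoltzmann α β h * cosMean M c h ^ 2))
      (energyRange M c) := by
    intro h hh
    have hpos := actionDeriv_pos hM c hh
    simp only [energyWeight_one hM c hh, ← actionDeriv_mul_cosMean hM c hh]
    rw [mul_div_cancel_left₀ _ hpos.ne']
  refine (integrableOn_congr_fun hEq (measurableSet_energyRange M c)).1 ?_
  refine Integrable.mono' hI hmeas.aestronglyMeasurable
    (ae_restrict_of_forall_mem (measurableSet_energyRange M c) fun h hh => ?_)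
  have hpos := actionDeriv_pos hM c hh
  have hw := maxwellBoltzmann_pos hα β h
  have h1 := (sq_le_one_iff_abs_le_one _).2 (abs_cosMean_le_one M c h)
  refine (congrArg norm (hEq hh)).trans_le ?_
  rw [Real.norm_eq_abs, abs_of_nonneg (by positivity), energyWeight_one hM c hh]
  exact mul_le_mul_of_nonneg_left (mul_le_of_le_one_right hw.le h1) hpos.le

/-- The contribution of one chart to the lower bound of `∑ ∫ G(h₀(a)) C₀(a)² da` by
`C₀² ≥ 2 t C₀ - t²`. -/
theorem chart_lower_bound {α β M : ℝ} (hα : 0 < α) (hβ : 0 < β) (hM : 0 < M) (c : Chart) (t : ℝ) :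
    2 * t * ((∫ h in energyRange M c,
          energyWeight M (fun y => 1 + y) h c * maxwellBoltzmann α β h)
        - ∫ h in energyRange M c, energyWeight M (fun _ => 1) h c * maxwellBoltzmann α β h)
      - t ^ 2 * (∫ h in energyRange M c,
          energyWeight M (fun _ => 1) h c * maxwellBoltzmann α β h)
    ≤ ∫ h in energyRange M c,
        actionDeriv M h c * (maxwellBoltzmann α β h * cosMean M c h ^ 2) := by
  have hI1 := (energy_integrals hα hβ hM (g := fun _ => 1) continuous_const
    fun _ _ => zero_le_one).1 c
  have hI2 := (energy_integrals hα hβ hM (g := fun y => 1 + y) (by fun_prop)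
    fun y hy => by linarith [hy.1]).1 c
  have hD : IntegrableOn (fun h => 2 * t * (energyWeight M (fun y => 1 + y) h c
      * maxwellBoltzmann α β h - energyWeight M (fun _ => 1) h c * maxwellBoltzmann α β h))
      (energyRange M c) := (hI2.sub hI1).const_mul _
  rw [← integral_sub hI2 hI1, ← integral_const_mul, ← integral_const_mul,
    ← integral_sub hD (hI1.const_mul _)]
  refine setIntegral_mono_on (hD.sub (hI1.const_mul _))
    (integrableOn_actionDeriv_mul_cosMean_sq hα hβ hM c) (measurableSet_energyRange M c)
    fun h hh => ?_
  have hpos := actionDeriv_pos hM c hh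
  have hw := maxwellBoltzmann_pos hα β h
  rw [energyWeight_one_add_id hM c hh, energyWeight_one hM c hh,
    ← actionDeriv_mul_cosMean hM c hh]
  have := mul_nonneg (mul_pos hpos hw).le (sq_nonneg (cosMean M c h - t))
  nlinarith

theorem actionIntegral_maxwellBoltzmann {α β M : ℝ} (hM : 0 < M) (c : Chart) :
    actionIntegral (maxwellBoltzmann α β) M c = -β * ∫ h in energyRange M c,
      actionDeriv M h c * (maxwellBoltzmann α β h * cosMean M c h ^ 2) := by
  have h := (integral_actionRange hM c fun h =>
    deriv (maxwellBoltzmann α β) h * cosMean M c h ^ 2).2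
  rw [actionIntegral]
  simp only [cosCoeff_eq_cosMean]
  rw [h, ← integral_const_mul]
  congr 1
  ext h
  rw [(hasDerivAt_maxwellBoltzmann α β h).deriv]
  ring

/-! ### Linear stability -/

theorem linearlyStable_maxwellBoltzmann {α β M : ℝ} (hα : 0 < α) (hβ : 0 < β) (hM : 0 < M)
    (hsc : SelfConsistent (maxwellBoltzmann α β) M) :
    LinearlyStable (maxwellBoltzmann α β) M := by
  have hπ := Real.pi_pos
  have hderiv : ∀ s, deriv (maxwellBoltzmann α β) s = -β * maxwellBoltzmann α β s :=
    fun s => (hasDerivAt_maxwellBoltzmann α β s).deriv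
  have hcos2 : (fun p : ℝ × ℝ => deriv (maxwellBoltzmann α β) (h0 M p.1 p.2) * Real.cos p.1 ^ 2)
      = fun p => -β * (Real.cos p.1 ^ 2 * state (maxwellBoltzmann α β) M p.1 p.2) := by
    ext p
    rw [hderiv, state]
    ring
  refine ⟨?_, fun c => ?_, ?_⟩
  · rw [hcos2]
    exact (integrable_mul_state hβ α M (q := fun x => Real.cos x ^ 2) (by fun_prop)).const_mul _
  · refine (integral_actionRange hM c fun h =>
      deriv (maxwellBoltzmann α β) h * cosMean M c h ^ 2).1.2 ?_
    refine ((integrableOn_actionDeriv_mul_cosMean_sq hα hβ hM c).const_mul (-β)).congr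
      (Filter.Eventually.of_forall fun h => ?_)
    simp only [hderiv]
    ring
  · rw [hcos2, integral_const_mul, integral_cos_pow_mul_state,
      actionIntegral_maxwellBoltzmann hM, actionIntegral_maxwellBoltzmann hM,
      actionIntegral_maxwellBoltzmann hM]
    have hz : 0 < β * M := mul_pos hβ hM
    have hA0 := cosExpIntegral_zero_pos (β * M)
    have hA1 := cosExpIntegral_one_pos hz
    have hparts := cosExpIntegral_by_parts (β * M)
    have hturan := turan_cosExpIntegral hz
    have hM1 := integral_cos_pow_mul_state α β M 1
    simp only [pow_one] at hM1
    rw [← hsc.2] at hM1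
    have h1 := (energy_integrals hα hβ hM (g := fun _ => 1) continuous_const
      fun _ _ => zero_le_one).2
    have h1' := integral_cos_pow_mul_state α β M 0
    simp only [pow_zero] at h1'
    rw [h1'] at h1
    have h2 := (energy_integrals hα hβ hM (g := fun y => 1 + y) (by fun_prop)
      fun y hy => by linarith [hy.1]).2
    have h2' := integral_add
      (integrable_mul_state hβ α M (q := fun _ => 1) continuous_const)
      (integrable_mul_state hβ α M Real.continuous_cos)
    simp only [← add_mul] at h2'
    rw [h1', ← hsc.2, h2] at h2'
    -- The mean of `cos x` under `η`, which maximizes the quadratic lower bound `2 t M - t² N A₀`;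
    -- its value there is `t M`.
    set t := cosExpIntegral 1 (β * M) / cosExpIntegral 0 (β * M) with ht
    have hp := chart_lower_bound hα hβ hM .plus t
    have hm := chart_lower_bound hα hβ hM .minus t
    have he := chart_lower_bound hα hβ hM .eye t
    set N := α * Real.sqrt (Real.pi / (β / 2)) * (2 * Real.pi)⁻¹
    have htA : t * cosExpIntegral 0 (β * M) = cosExpIntegral 1 (β * M) := by
      rw [ht]; field_simp
    have hsum := add_le_add (add_le_add hp hm) he
    set S := (∫ h in energyRange M .plus,
        actionDeriv M h .plus * (maxwellBoltzmann α β h * cosMean M .plus h ^ 2))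
      + (∫ h in energyRange M .minus,
        actionDeriv M h .minus * (maxwellBoltzmann α β h * cosMean M .minus h ^ 2))
      + ∫ h in energyRange M .eye,
        actionDeriv M h .eye * (maxwellBoltzmann α β h * cosMean M .eye h ^ 2) with hS
    have hS' : t * M ≤ S := by
      have e1 : t ^ 2 * (N * cosExpIntegral 0 (β * M)) = t * M := by
        rw [show t ^ 2 * (N * cosExpIntegral 0 (β * M))
          = t * (N * (t * cosExpIntegral 0 (β * M))) by ring, htA, ← hM1]
      linear_combination hsum - 2 * t * (h2' + h1) - t ^ 2 * h1 + e1
    have hfin : 0 < 1 - β * (N * cosExpIntegral 2 (β * M)) + β * (t * M) := by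
      generalize cosExpIntegral 0 (β * M) = A0 at *
      generalize cosExpIntegral 1 (β * M) = A1 at *
      generalize cosExpIntegral 2 (β * M) = A2 at *
      -- Clearing denominators with `M = N A₁`, `t A₀ = A₁` and the integration by parts leaves the
      -- Turán difference.
      have hprod : A1 * A0 * (1 - β * (N * A2) + β * (t * M))
          = 2 * A0 * A1 - β * M * (A0 ^ 2 - A1 ^ 2) := by
        have e2 : β * M * A2 = β * M * A0 - A1 := by linarith
        have e3 : A1 * A0 * (β * (N * A2)) = A0 * (β * M * A2) := by
          rw [show β * M * A2 = β * (N * A1) * A2 by rw [← hM1]]; ring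
        have e4 : A1 * A0 * (β * (t * M)) = β * M * A1 ^ 2 := by
          rw [show A1 * A0 * (β * (t * M)) = A1 * β * M * (t * A0) by ring, htA]; ring
        rw [mul_add, mul_sub, e3, e4, e2]
        ring
      have : 0 < A1 * A0 * (1 - β * (N * A2) + β * (t * M)) := by rw [hprod]; linarith
      exact (mul_pos_iff_of_pos_left (mul_pos hA1 hA0)).1 this
    have := mul_le_mul_of_nonneg_left hS' hβ.le
    linarith

/-! ### Existence of the magnetization -/

theorem exists_selfConsistent_maxwellBoltzmann {α β : ℝ} (hα : 0 < α) (hβ : 0 < β)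
    (h : α ^ 2 * β < 2 / Real.pi) :
    ∃ M : ℝ, 0 < M ∧ SelfConsistent (maxwellBoltzmann α β) M := by
  have hπ := Real.pi_pos
  -- In the variable `z = β M` self-consistency is `2π z = c A₁(z)`. Since `c² = 2π α² β`, the
  -- hypothesis is equivalent to `c < 2`.
  set c := α * β * Real.sqrt (Real.pi / (β / 2)) with hc
  have hc0 : 0 < c := by positivity
  have hc2 : c < 2 := by
    refine lt_of_pow_lt_pow_left₀ 2 (by norm_num) ?_
    have : c ^ 2 = 2 * (α ^ 2 * β * Real.pi) := by
      rw [hc, mul_pow, Real.sq_sqrt (by positivity)]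
      field_simp
    rw [lt_div_iff₀ hπ] at h
    linarith
  obtain ⟨z, hz, hzc⟩ := exists_pos_eq_cosExpIntegral hc0 hc2
  refine ⟨z / β, by positivity, integrable_mul_state hβ α _ Real.continuous_cos, ?_⟩
  have h1 := integral_cos_pow_mul_state α β (z / β) 1
  simp only [pow_one] at h1
  rw [h1, mul_div_cancel₀ _ hβ.ne']
  rw [hc] at hzc
  generalize Real.sqrt (Real.pi / (β / 2)) = s at hzc
  field_simp
  linarith

end

end HMF

theorem proposition2p9 (α β : ℝ) (hα : 0 < α) (hβ : 0 < β) (h : α ^ 2 * β < 2 / Real.pi) :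
    ∃ M₀ : ℝ, 0 < M₀ ∧
      HMF.SelfConsistent (HMF.maxwellBoltzmann α β) M₀ ∧
      HMF.IsStationarySolution (HMF.state (HMF.maxwellBoltzmann α β) M₀) ∧
      HMF.LinearlyStable (HMF.maxwellBoltzmann α β) M₀ := by
  obtain ⟨M, hM, hsc⟩ := HMF.exists_selfConsistent_maxwellBoltzmann hα hβ h
  exact ⟨M, hM, hsc, HMF.isStationarySolution_state hβ hsc,
    HMF.linearlyStable_maxwellBoltzmann hα hβ hM hsc⟩
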